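/- Let $d\ge 1$, $s\in(\tfrac12,1]$, and let $\Omega\subset\mathbb R^d$ be a tiling domain of finite volume $|\Omega|$, that is, a nonempty open set such that $\mathbb R^d$ is covered, up to a null set, by pairwise disjoint congruent copies of $\Omega$. Let $\mathcal E_1\le \mathcal E_2\le\cdots$ be the eigenvalues, in increasing order and repeated according to multiplicity, of the homogeneous Dirichlet problem $$\sum_{i=1}^d(-\partial_i^2)^s\psi=\mathcal E\psi\ \text{ in }\Omega,\qquad \psi=0\ \text{ outside }\Omega .$$ Here $\sum_{i=1}^d(-\partial_i^2)^s$ is the Fourier multiplier with symbol $\|p\|^{2s}=\sum_{i=1}^d|p_i|^{2s}$, and the problem is understood weakly: $0\ne\psi$ lies in the closure of $C_c^\infty(\Omega)$ under the norm $\big(\int_{\mathbb R^d}(1+\|p\|^{2s})|\hat\psi(p)|^2\,dp\big)^{1/2}$, and $\int_{\mathbb R^d}\|p\|^{2s}\hat\psi(p)\overline{\hat v(p)}\,dp=\mathcal E\int_\Omega\psi\bar v\,dx$ for all $v\in C_c^\infty(\Omega)$, where $\hat\psi(p)=(2\pi)^{-d/2}\int e^{-i\langle p,x\rangle}\psi(x)\,dx$.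 Let $$|A_{d-1,2s}|=\frac{2s\,\big(2\Gamma(1+\frac1{2s})\big)^d}{\Gamma(\frac d{2s})},$$ which is $d$ times the volume of $\{x\in\mathbb R^d:\sum_i|x_i|^{2s}\le1\}$. Then for every $N\in\mathbb N$ the sum $S(N)=\sum_{n=1}^N\mathcal E_n$ satisfies $$S(N)\ \ge\ (2\pi)^{2s}\,\frac{d}{d+2s}\left(\frac{d}{|A_{d-1,2s}|\,|\Omega|}\right)^{2s/d}N^{\,1+2s/d}.$$ -/

import Mathlib

open MeasureTheory FourierTransform SchwartzMap

noncomputable section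

namespace AnisotropicDirichlet

/-- `L²(ℝᵈ; ℂ)`. -/
abbrev L2 (d : ℕ) : Type :=
  Lp (α := EuclideanSpace ℝ (Fin d)) ℂ 2 volume

/-- The symbol of `∑ᵢ (-∂ᵢ²)ˢ`. The symbol is `∑ᵢ |pᵢ|^{2s}` in the momentum variable `p` of the
Fourier transform with kernel `(2π)^{-d/2} e^{-i⟨p,x⟩}`. Mathlib's `𝓕` has the kernel
`e^{-2πi⟨ξ,x⟩}`, so `p = 2πξ`; both transforms are unitary on `L²(ℝᵈ)`. -/
def symbol {d : ℕ} (s : ℝ) (ξ : EuclideanSpace ℝ (Fin d)) : ℝ :=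
  ∑ i, |2 * Real.pi * ξ i| ^ (2 * s)

/-- The energy `⟨u, ∑ᵢ (-∂ᵢ²)ˢ u⟩ ∈ [0, ∞]` of `u ∈ L²(ℝᵈ)`. -/
def energy {d : ℕ} (s : ℝ) (u : L2 d) : ENNReal :=
  ∫⁻ ξ, ENNReal.ofReal (symbol s ξ) * ‖(𝓕 u) ξ‖ₑ ^ 2

/-- The sesquilinear form `∫ ∑ᵢ |pᵢ|^{2s} û(p) conj (v̂(p)) dp` of `∑ᵢ (-∂ᵢ²)ˢ`; the integrand is
integrable when `u` and `v` have finite energy. -/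
def form {d : ℕ} (s : ℝ) (u v : L2 d) : ℂ :=
  ∫ ξ, (symbol s ξ : ℂ) * ((𝓕 u) ξ * (starRingEnd ℂ) ((𝓕 v) ξ))

/-- `v` is (the class of) a test function in `C_c^∞(Ω)`, extended by zero to `ℝᵈ`. -/
def IsTestFunction {d : ℕ} (Ω : Set (EuclideanSpace ℝ (Fin d))) (v : L2 d) : Prop :=
  ∃ φ : 𝓢(EuclideanSpace ℝ (Fin d), ℂ),
    HasCompactSupport φ ∧ tsupport φ ⊆ Ω ∧ v = φ.toLp 2

/-- The energy space of the homogeneous Dirichlet problem in `Ω`: the closure of `C_c^∞(Ω)` in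
`L²(ℝᵈ)` with respect to the norm `(‖u‖² + energy u)^{1/2}`. Its elements vanish almost everywhere
outside `Ω` and have finite energy. -/
def MemDirichletSpace {d : ℕ} (s : ℝ) (Ω : Set (EuclideanSpace ℝ (Fin d))) (u : L2 d) : Prop :=
  ∀ ε : ENNReal, 0 < ε → ∃ v : L2 d, IsTestFunction Ω v ∧ ‖u - v‖ₑ ^ 2 + energy s (u - v) < ε

/-- `u` is an eigenfunction, with eigenvalue `E`, of the homogeneous Dirichlet problem
`∑ᵢ (-∂ᵢ²)ˢ u = E u` in `Ω`, `u = 0` outside `Ω`: the equation holds weakly in `Ω`. -/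
def IsDirichletEigenfunction {d : ℕ} (s : ℝ) (Ω : Set (EuclideanSpace ℝ (Fin d))) (E : ℝ)
    (u : L2 d) : Prop :=
  u ≠ 0 ∧ MemDirichletSpace s Ω u ∧
    ∀ v : L2 d, IsTestFunction Ω v → form s u v = (E : ℂ) * inner ℂ v u

/-- At least `n` eigenvalues, counted with multiplicity, are at most `t`. -/
def HasEigenvaluesBelow {d : ℕ} (s : ℝ) (Ω : Set (EuclideanSpace ℝ (Fin d))) (n : ℕ) (t : ℝ) :
    Prop :=
  ∃ u : Fin n → L2 d, LinearIndependent ℂ u ∧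
    ∀ i, ∃ E : ℝ, E ≤ t ∧ IsDirichletEigenfunction s Ω E (u i)

/-- The `n`-th Dirichlet eigenvalue of `∑ᵢ (-∂ᵢ²)ˢ` in `Ω`, for `n = 1, 2, …`: the eigenvalues are
arranged in increasing order and repeated according to multiplicity. (As real numbers, `sInf ∅ = 0`;
so a positive lower bound for the `n`-th eigenvalue says in particular that there are at least `n`
of them.) -/
def eigenvalue {d : ℕ} (s : ℝ) (Ω : Set (EuclideanSpace ℝ (Fin d))) (n : ℕ) : ℝ :=
  sInf {t : ℝ | HasEigenvaluesBelow s Ω n t}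

/-- `S(N)`, the sum of the first `N` Dirichlet eigenvalues. -/
def eigenvalueSum {d : ℕ} (s : ℝ) (Ω : Set (EuclideanSpace ℝ (Fin d))) (N : ℕ) : ℝ :=
  ∑ n ∈ Finset.Icc 1 N, eigenvalue s Ω n

/-- `|A_{d-1,2s}| = 2s (2 Γ(1 + 1/(2s)))^d / Γ(d/(2s))`, the size of the `2s`-deformed unit sphere
(`d` times the volume of the unit ball `∑ᵢ |xᵢ|^{2s} ≤ 1`). -/
def sphereVolume (d : ℕ) (s : ℝ) : ℝ :=
  2 * s * (2 * Real.Gamma (1 + 1 / (2 * s))) ^ d / Real.Gamma (d / (2 * s))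

/-- A tiling domain of finite volume: a nonempty open set of which pairwise disjoint congruent
copies fill `ℝᵈ` up to a null set. Connectedness is not asked for, and the copies may be images
under arbitrary isometries; domains that tile by translations are a special case. -/
structure IsTilingDomain {d : ℕ} (Ω : Set (EuclideanSpace ℝ (Fin d))) : Prop where
  isOpen : IsOpen Ω
  nonempty : Ω.Nonempty
  volume_lt_top : volume Ω < ⊤
  tiles : ∃ G : Set (EuclideanSpace ℝ (Fin d) ≃ᵢ EuclideanSpace ℝ (Fin d)),
    G.PairwiseDisjoint (fun g => g '' Ω) ∧ volume (⋃ g ∈ G, g '' Ω)ᶜ = 0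

end AnisotropicDirichlet

end

noncomputable section

namespace AnisotropicDirichlet

open scoped ENNReal NNReal InnerProductSpace

variable {d : ℕ}

/-! The argument is that of Berezin and Li–Yau. For an orthonormal system of `N` functions vanishing
off `Ω`, let `F` be the sum of the squared moduli of their Fourier transforms. Plancherel gives `∫ F
= N`, the total energy is `∫ symbol * F`, and Bessel's inequality for characters restricted to `Ω`
gives `F ≤ |Ω|`. Hence `t N ≤ total energy + |Ω| ∫ (t - symbol)₊` for all `t ≥ 0`; optimising in `t`
gives `le_sum_energy_toReal`.

Two points link this to eigenvalues. First, since `sInf ∅ = 0`, each set defining an eigenvalue must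
be shown nonempty (`exists_hasEigenvaluesBelow`): the Green operator is compact and symmetric, and
if its eigenvectors with nonzero eigenvalue spanned a finite-dimensional space, that space would
contain all test functions. Second, `exists_orthonormal_sum_energy_le` builds an orthonormal system
whose total energy is at most the sum of chosen upper bounds for the eigenvalues. -/

/-! ### Multiplication operators and the Fourier transform on `L²` -/

lemma memLp_ofReal_mul {m : EuclideanSpace ℝ (Fin d) → ℝ}
    (hm : Measurable m ∧ ∀ x, |m x| ≤ 1) (f : L2 d) :
    MemLp (fun x => (m x : ℂ) * f x) 2 volume := by
  refine (Lp.memLp f).mono ?_ ?_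
  · exact (Complex.measurable_ofReal.comp hm.1).aestronglyMeasurable.mul
      (Lp.aestronglyMeasurable f)
  · refine Filter.Eventually.of_forall fun x => ?_
    rw [norm_mul, Complex.norm_real, Real.norm_eq_abs]
    exact mul_le_of_le_one_left (norm_nonneg _) (hm.2 x)

/-- Multiplication by a real measurable function bounded by one, as an operator on `L²`. -/
def mulOp (m : EuclideanSpace ℝ (Fin d) → ℝ) (hm : Measurable m ∧ ∀ x, |m x| ≤ 1) :
    L2 d →L[ℂ] L2 d :=
  LinearMap.mkContinuous
    { toFun := fun f => (memLp_ofReal_mul hm f).toLp _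
      map_add' := fun f g => by
        rw [← MemLp.toLp_add, MemLp.toLp_eq_toLp_iff]
        filter_upwards [Lp.coeFn_add f g] with x hx
        change (m x : ℂ) * (f + g : L2 d) x = _
        rw [hx, Pi.add_apply, mul_add]
        rfl
      map_smul' := fun c f => by
        rw [RingHom.id_apply, ← MemLp.toLp_const_smul, MemLp.toLp_eq_toLp_iff]
        filter_upwards [Lp.coeFn_smul c f] with x hx
        simp [hx, mul_left_comm] } 1
    (fun f => by
      rw [one_mul]
      refine Lp.norm_le_norm_of_ae_le ?_
      filter_upwards [(memLp_ofReal_mul hm f).coeFn_toLp] with x hx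
      simp only [LinearMap.coe_mk, AddHom.coe_mk, hx]
      rw [norm_mul, Complex.norm_real, Real.norm_eq_abs]
      exact mul_le_of_le_one_left (norm_nonneg _) (hm.2 x))

lemma coeFn_mulOp (m : EuclideanSpace ℝ (Fin d) → ℝ) (hm : Measurable m ∧ ∀ x, |m x| ≤ 1)
    (f : L2 d) : mulOp m hm f =ᵐ[volume] fun x => (m x : ℂ) * f x :=
  (memLp_ofReal_mul hm f).coeFn_toLp

lemma inner_mulOp_left (m : EuclideanSpace ℝ (Fin d) → ℝ) (hm : Measurable m ∧ ∀ x, |m x| ≤ 1)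
    (f g : L2 d) : inner ℂ (mulOp m hm f) g = inner ℂ f (mulOp m hm g) := by
  rw [L2.inner_def, L2.inner_def]
  refine integral_congr_ae ?_
  filter_upwards [coeFn_mulOp m hm f, coeFn_mulOp m hm g] with x h1 h2
  rw [h1, h2]
  simp only [RCLike.inner_apply, map_mul, Complex.conj_ofReal]
  ring

lemma enorm_sq_eq_lintegral (f : L2 d) : ‖f‖ₑ ^ 2 = ∫⁻ x, ‖f x‖ₑ ^ 2 := by
  rw [Lp.enorm_def, eLpNorm_eq_lintegral_rpow_enorm_toReal (by norm_num) (by norm_num),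
    ← ENNReal.rpow_natCast, ← ENNReal.rpow_mul]
  simp

lemma norm_mulOp_le (m : EuclideanSpace ℝ (Fin d) → ℝ) (hm : Measurable m ∧ ∀ x, |m x| ≤ 1)
    {c : ℝ} (hc : ∀ x, |m x| ≤ c) (f : L2 d) : ‖mulOp m hm f‖ ≤ c * ‖f‖ := by
  refine Lp.norm_le_mul_norm_of_ae_le_mul ?_
  filter_upwards [coeFn_mulOp m hm f] with x hx
  rw [hx, norm_mul, Complex.norm_real, Real.norm_eq_abs]
  exact mul_le_mul_of_nonneg_right (hc x) (norm_nonneg _)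

/-- On `L¹ ∩ L²` the Fourier transform on `L²` is given by the Fourier integral. -/
lemma fourier_ae_eq_of_integrable (f : L2 d) (hf : Integrable f) :
    (𝓕 f : L2 d) =ᵐ[volume] 𝓕 (f : EuclideanSpace ℝ (Fin d) → ℂ) := by
  have hcont : Continuous (𝓕 (f : EuclideanSpace ℝ (Fin d) → ℂ)) :=
    VectorFourier.fourierIntegral_continuous Real.continuous_fourierChar
      continuous_inner hf
  -- Both sides are tested against smooth compactly supported `φ`. Each pairing equals `∫ 𝓕 φ • f`:
  -- one by duality for tempered distributions, the other by the self-adjointness of the Fourier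
  -- integral.
  refine ae_eq_of_integral_contDiff_smul_eq
    ((Lp.memLp (𝓕 f : L2 d)).locallyIntegrable (by norm_num)) hcont.locallyIntegrable ?_
  intro g hg hgc
  have hg1 : HasCompactSupport (Complex.ofRealCLM ∘ g) := hgc.comp_left (by simp)
  have hg2 : ContDiff ℝ (⊤ : ℕ∞) (Complex.ofRealCLM ∘ g) :=
    Complex.ofRealCLM.contDiff.comp hg
  set φ : 𝓢(EuclideanSpace ℝ (Fin d), ℂ) := hg1.toSchwartzMap hg2 with hφ
  have hφx : ∀ x, φ x = (g x : ℂ) := fun x => rfl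
  have h1 : ∫ x, φ x • (𝓕 f : L2 d) x = ∫ x, (𝓕 φ) x • f x := by
    rw [← Lp.toTemperedDistribution_apply, ← Lp.fourier_toTemperedDistribution_eq,
      ← Lp.toTemperedDistribution_apply]
    rfl
  have h2 : ∫ x, (𝓕 φ) x • f x = ∫ x, φ x • 𝓕 (f : EuclideanSpace ℝ (Fin d) → ℂ) x := by
    have := VectorFourier.integral_fourierIntegral_smul_eq_flip (L := innerₗ _)
      (μ := volume) (ν := volume) Real.continuous_fourierChar
      continuous_inner (φ.integrable (μ := volume)) hf
    simp only [flip_innerₗ] at this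
    exact this
  simp only [hφx] at h1 h2
  simpa [Complex.real_smul] using h1.trans h2

/-! ### Restriction to `Ω` and the Bessel bound -/

lemma measurable_abs_indicator_one {Ω : Set (EuclideanSpace ℝ (Fin d))} (hΩ : MeasurableSet Ω) :
    Measurable (Ω.indicator (1 : EuclideanSpace ℝ (Fin d) → ℝ)) ∧
      ∀ x, |Ω.indicator (1 : EuclideanSpace ℝ (Fin d) → ℝ) x| ≤ 1 := by
  refine ⟨measurable_one.indicator hΩ, fun x => ?_⟩
  by_cases hx : x ∈ Ω <;> simp [hx]

/-- Restriction of a function in `L²` to a measurable set. -/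
def cutoff (Ω : Set (EuclideanSpace ℝ (Fin d))) (hΩ : MeasurableSet Ω) : L2 d →L[ℂ] L2 d :=
  mulOp (Ω.indicator 1) (measurable_abs_indicator_one hΩ)

lemma coeFn_cutoff {Ω : Set (EuclideanSpace ℝ (Fin d))} (hΩ : MeasurableSet Ω) (f : L2 d) :
    cutoff Ω hΩ f =ᵐ[volume] Ω.indicator f := by
  filter_upwards [coeFn_mulOp _ (measurable_abs_indicator_one hΩ) f] with x hx
  rw [cutoff, hx]
  by_cases h : x ∈ Ω <;> simp [h]

lemma inner_cutoff_left {Ω : Set (EuclideanSpace ℝ (Fin d))} (hΩ : MeasurableSet Ω) (f g : L2 d) :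
    inner ℂ (cutoff Ω hΩ f) g = inner ℂ f (cutoff Ω hΩ g) :=
  inner_mulOp_left _ _ f g

lemma integrable_cutoff {Ω : Set (EuclideanSpace ℝ (Fin d))} (hΩ : MeasurableSet Ω)
    (hv : volume Ω < ⊤) (f : L2 d) : Integrable (cutoff Ω hΩ f) := by
  refine Integrable.congr ?_ (coeFn_cutoff hΩ f).symm
  rw [integrable_indicator_iff hΩ]
  have : IsFiniteMeasure (volume.restrict Ω) := ⟨by simpa using hv⟩
  exact ((Lp.memLp f).restrict Ω).integrable (by norm_num)

lemma memLp_indicator_exp {Ω : Set (EuclideanSpace ℝ (Fin d))} (hΩ : MeasurableSet Ω)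
    (hv : volume Ω < ⊤) (ξ : EuclideanSpace ℝ (Fin d)) :
    MemLp (Ω.indicator fun x => Complex.exp ((2 * Real.pi * ⟪x, ξ⟫_ℝ : ℝ) * Complex.I)) 2 volume := by
  have : IsFiniteMeasure (volume.restrict Ω) := ⟨by simpa using hv⟩
  rw [memLp_indicator_iff_restrict hΩ]
  refine MemLp.of_bound ?_ 1 (Filter.Eventually.of_forall fun x => ?_)
  · exact Continuous.aestronglyMeasurable (by fun_prop)
  · rw [Complex.norm_exp_ofReal_mul_I]

/-- Bessel's inequality for the characters `e^{2πi⟨x, ξ⟩}` restricted to `Ω`. -/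
lemma sum_norm_fourier_cutoff_sq_le {ι : Type*} [Fintype ι]
    {Ω : Set (EuclideanSpace ℝ (Fin d))} (hΩ : MeasurableSet Ω) (hv : volume Ω < ⊤)
    {f : ι → L2 d} (hf : Orthonormal ℂ f) :
    ∀ᵐ ξ, ∑ i, ‖(𝓕 (cutoff Ω hΩ (f i)) : L2 d) ξ‖ ^ 2 ≤ (volume Ω).toReal := by
  have h : ∀ i, ∀ᵐ ξ, (𝓕 (cutoff Ω hΩ (f i)) : L2 d) ξ
      = 𝓕 (cutoff Ω hΩ (f i) : EuclideanSpace ℝ (Fin d) → ℂ) ξ := fun i =>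
    fourier_ae_eq_of_integrable _ (integrable_cutoff hΩ hv _)
  filter_upwards [ae_all_iff.2 h] with ξ hξ
  -- The Fourier value at `ξ` is the inner product with this one vector, whose squared norm is `|Ω|`
  -- whatever `ξ` is.
  set e : L2 d := (memLp_indicator_exp hΩ hv ξ).toLp _ with he
  have hinner : ∀ i, (𝓕 (cutoff Ω hΩ (f i)) : L2 d) ξ = inner ℂ e (f i) := by
    intro i
    rw [hξ, Real.fourier_eq', L2.inner_def]
    refine integral_congr_ae ?_
    filter_upwards [coeFn_cutoff hΩ (f i), (memLp_indicator_exp hΩ hv ξ).coeFn_toLp]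
      with x h1 h2
    rw [h1, he, h2]
    by_cases hx : x ∈ Ω
    · simp only [hx, Set.indicator_of_mem, RCLike.inner_apply, smul_eq_mul]
      rw [← Complex.exp_conj, mul_comm]
      congr 2
      simp only [map_mul, Complex.conj_ofReal, Complex.conj_I]
      push_cast
      ring
    · simp [hx]
  have hnorm : ‖e‖ ^ 2 = (volume Ω).toReal := by
    have h1 : ‖e‖ₑ ^ 2 = volume Ω := by
      rw [enorm_sq_eq_lintegral, ← lintegral_indicator_one hΩ]
      refine lintegral_congr_ae ?_
      filter_upwards [(memLp_indicator_exp hΩ hv ξ).coeFn_toLp] with x h2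
      rw [he, h2]
      by_cases hx : x ∈ Ω
      · simp only [hx, Set.indicator_of_mem, ← ofReal_norm, Complex.norm_exp_ofReal_mul_I]
        simp
      · simp [hx]
    rw [← h1, ENNReal.toReal_pow, toReal_enorm]
  rw [← hnorm]
  refine le_trans (le_of_eq ?_) (hf.sum_inner_products_le e (s := Finset.univ))
  refine Finset.sum_congr rfl fun i _ => ?_
  rw [hinner, norm_inner_symm]

/-! ### A Hilbert–Schmidt criterion for compactness -/

section Compact

variable {H H' : Type*} [NormedAddCommGroup H] [InnerProductSpace ℂ H]
  [NormedAddCommGroup H'] [InnerProductSpace ℂ H']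

lemma orthonormal_fin_cons {n : ℕ} {f : Fin n → H} (hf : Orthonormal ℂ f) {x : H}
    (hx : ‖x‖ = 1) (hxf : ∀ i, inner ℂ (f i) x = 0) :
    Orthonormal ℂ (Fin.cons x f : Fin (n + 1) → H) := by
  refine ⟨fun i => ?_, fun i j hij => ?_⟩
  · refine Fin.cases ?_ (fun i => ?_) i
    · simpa using hx
    · simpa using hf.1 i
  · induction i using Fin.cases with
    | zero =>
      induction j using Fin.cases with
      | zero => exact absurd rfl hij
      | succ j => simpa using inner_eq_zero_symm.1 (hxf j)
    | succ i =>
      induction j using Fin.cases with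
      | zero => simpa using hxf i
      | succ j => simpa using hf.2 fun h => hij (by rw [h])

/-- A bounded operator of finite Hilbert–Schmidt norm is compact. -/
lemma isCompactOperator_of_sum_norm_sq_le [CompleteSpace H'] (A : H →L[ℂ] H') (C : ℝ)
    (hA : ∀ (n : ℕ) (f : Fin n → H), Orthonormal ℂ f → ∑ i, ‖A (f i)‖ ^ 2 ≤ C) :
    IsCompactOperator A := by
  have hcl := isClosed_setOfPred_isCompactOperator (σ₁₂ := RingHom.id ℂ) (M₁ := H) (M₂ := H')
  refine hcl.closure_subset (Metric.mem_closure_iff.2 fun ε hε => ?_)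
  set S : Set ℝ := {r | ∃ (n : ℕ) (f : Fin n → H), Orthonormal ℂ f ∧ r = ∑ i, ‖A (f i)‖ ^ 2}
  have hbdd : BddAbove S := ⟨C, by rintro r ⟨n, f, hf, rfl⟩; exact hA n f hf⟩
  have hne : S.Nonempty := ⟨_, 0, Fin.elim0, ⟨fun i => i.elim0, fun i => i.elim0⟩, rfl⟩
  -- The system `f` almost attains the supremum. Adjoining a unit vector orthogonal to it can add at
  -- most `(ε / 2) ^ 2`, so `A` has norm at most `ε / 2` on the orthogonal complement of the span.
  obtain ⟨_, ⟨n, f, hf, rfl⟩, hlt⟩ :=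
    exists_lt_of_lt_csSup hne (sub_lt_self (sSup S) (by positivity : 0 < (ε / 2) ^ 2))
  set V := Submodule.span ℂ (Set.range f)
  have hV : FiniteDimensional ℂ V := FiniteDimensional.span_of_finite ℂ (Set.finite_range f)
  have hperp : ∀ x ∈ Vᗮ, ‖A x‖ ≤ ε / 2 * ‖x‖ := by
    intro x hx
    rcases eq_or_ne x 0 with rfl | hx0
    · simp
    have hxn : 0 < ‖x‖ := norm_pos_iff.2 hx0
    set y : H := ((‖x‖⁻¹ : ℝ) : ℂ) • x with hy
    have hyn : ‖y‖ = 1 := by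
      rw [hy, norm_smul, Complex.norm_real, Real.norm_eq_abs, abs_of_pos (by positivity),
        inv_mul_cancel₀ hxn.ne']
    have hyf : ∀ i, inner ℂ (f i) y = 0 := fun i => by
      rw [hy, inner_smul_right, (Submodule.mem_orthogonal _ _).1 hx _
        (Submodule.subset_span ⟨i, rfl⟩), mul_zero]
    have h1 := le_csSup hbdd ⟨n + 1, _, orthonormal_fin_cons hf hyn hyf, rfl⟩
    rw [Fin.sum_univ_succ] at h1
    simp only [Fin.cons_zero, Fin.cons_succ] at h1
    have h2 : ‖A y‖ ^ 2 ≤ (ε / 2) ^ 2 := by linarith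
    have h3 : ‖A y‖ ≤ ε / 2 := (sq_le_sq₀ (norm_nonneg _) (by positivity)).1 h2
    rw [hy, map_smul, norm_smul, Complex.norm_real, Real.norm_eq_abs,
      abs_of_pos (by positivity)] at h3
    rwa [inv_mul_le_iff₀ hxn, mul_comm] at h3
  refine ⟨A ∘L V.starProjection, ?_, ?_⟩
  · have h1 : IsCompactOperator V.orthogonalProjectionOnto :=
      isCompactOperator_of_locallyCompactSpace_dom _
    exact h1.clm_comp (A ∘L V.subtypeL)
  · rw [dist_eq_norm]
    refine lt_of_le_of_lt (ContinuousLinearMap.opNorm_le_bound _ (by positivity) fun x => ?_)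
      (half_lt_self hε)
    have hx : x - V.starProjection x ∈ Vᗮ := V.sub_starProjection_mem_orthogonal x
    calc ‖(A - A ∘L V.starProjection) x‖ = ‖A (x - V.starProjection x)‖ := by simp
      _ ≤ ε / 2 * ‖x - V.starProjection x‖ := hperp _ hx
      _ ≤ ε / 2 * ‖x‖ := by
        rw [← V.starProjection_orthogonal_val]
        gcongr
        exact Vᗮ.norm_starProjection_apply_le x

end Compact

/-! ### Volumes of sublevel sets of the symbol -/

lemma symbol_nonneg (s : ℝ) (ξ : EuclideanSpace ℝ (Fin d)) : 0 ≤ symbol s ξ :=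
  Finset.sum_nonneg fun _ _ => Real.rpow_nonneg (abs_nonneg _) _

lemma measurable_symbol (s : ℝ) :
    Measurable (symbol s : EuclideanSpace ℝ (Fin d) → ℝ) := by
  unfold symbol
  fun_prop

lemma measurableSet_symbol_le (s t : ℝ) :
    MeasurableSet {ξ : EuclideanSpace ℝ (Fin d) | symbol s ξ ≤ t} :=
  measurableSet_le (measurable_symbol s) measurable_const

/-- The volume of `{ξ | symbol s ξ ≤ 1}`. -/
def unitVolume (d : ℕ) (s : ℝ) : ℝ :=
  (2 * Real.pi)⁻¹ ^ d *
    ((2 * Real.Gamma (1 / (2 * s) + 1)) ^ d / Real.Gamma (d / (2 * s) + 1))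

lemma unitVolume_pos (d : ℕ) {s : ℝ} (hs : 1 / 2 < s) : 0 < unitVolume d s := by
  have h1 : 0 < Real.Gamma (1 / (2 * s) + 1) := Real.Gamma_pos_of_pos (by positivity)
  have h2 : 0 < Real.Gamma (d / (2 * s) + 1) := Real.Gamma_pos_of_pos (by positivity)
  have := Real.pi_pos
  unfold unitVolume
  positivity

/-- The set is an `ℓ^{2s}` ball of radius `t^{1/(2s)} / (2π)`. The volume formula used requires the
exponent `2s` to be at least one. -/
lemma volume_symbol_le (hd : 1 ≤ d) {s : ℝ} (hs : 1 / 2 < s) {t : ℝ} (ht : 0 ≤ t) :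
    volume {ξ : EuclideanSpace ℝ (Fin d) | symbol s ξ ≤ t} =
      ENNReal.ofReal (unitVolume d s * t ^ (d / (2 * s))) := by
  have hp : (1 : ℝ) ≤ 2 * s := by linarith
  have hp0 : 0 < 2 * s := by linarith
  have hpi := Real.pi_pos
  have : Nonempty (Fin d) := ⟨⟨0, hd⟩⟩
  have hset : {ξ : EuclideanSpace ℝ (Fin d) | symbol s ξ ≤ t} =
      WithLp.ofLp ⁻¹'
        {x : Fin d → ℝ | (∑ i, |x i| ^ (2 * s)) ^ (1 / (2 * s)) ≤
          t ^ (1 / (2 * s)) / (2 * Real.pi)} := by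
    ext ξ
    simp only [Set.mem_ofPred_eq, Set.mem_preimage]
    have h0 : 0 ≤ ∑ i, |ξ i| ^ (2 * s) :=
      Finset.sum_nonneg fun _ _ => Real.rpow_nonneg (abs_nonneg _) _
    have h1 : symbol s ξ = (2 * Real.pi) ^ (2 * s) * ∑ i, |ξ i| ^ (2 * s) := by
      rw [symbol, Finset.mul_sum]
      refine Finset.sum_congr rfl fun i _ => ?_
      rw [abs_mul, Real.mul_rpow (abs_nonneg _) (abs_nonneg _), abs_of_pos (by positivity)]
    have h2 : (symbol s ξ) ^ (1 / (2 * s)) =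
        2 * Real.pi * (∑ i, |ξ i| ^ (2 * s)) ^ (1 / (2 * s)) := by
      rw [h1, Real.mul_rpow (by positivity) h0, ← Real.rpow_mul (by positivity),
        mul_one_div_cancel hp0.ne', Real.rpow_one]
    rw [← Real.rpow_le_rpow_iff (symbol_nonneg s ξ) ht (by positivity : 0 < 1 / (2 * s)), h2,
      le_div_iff₀ (by positivity), mul_comm]
  rw [hset, (PiLp.volume_preserving_ofLp (Fin d)).measure_preimage
      (measurableSet_le (by fun_prop) measurable_const).nullMeasurableSet, volume_sum_rpow_le _ hp, ← ENNReal.ofReal_pow (by positivity),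
    ← ENNReal.ofReal_mul (by positivity), unitVolume, Fintype.card_fin]
  congr 1
  rw [div_pow, ← Real.rpow_natCast (t ^ (1 / (2 * s))), ← Real.rpow_mul ht, inv_pow,
    one_div_mul_eq_div]
  ring

lemma volume_symbol_le_lt_top (hd : 1 ≤ d) {s : ℝ} (hs : 1 / 2 < s) (t : ℝ) :
    volume {ξ : EuclideanSpace ℝ (Fin d) | symbol s ξ ≤ t} < ⊤ := by
  refine lt_of_le_of_lt (measure_mono ?_)
    ((volume_symbol_le hd hs (le_max_right t 0)).trans_lt ENNReal.ofReal_lt_top)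
  intro ξ (hξ : symbol s ξ ≤ t)
  exact hξ.trans (le_max_left _ _)

/-- `ENNReal.ofReal` truncates, so this integrates the positive part; the layer-cake formula reduces
it to the volumes of `{symbol ≤ t - r}` for `0 < r ≤ t`. -/
lemma lintegral_sub_symbol (hd : 1 ≤ d) {s : ℝ} (hs : 1 / 2 < s) {t : ℝ} (ht : 0 ≤ t) :
    ∫⁻ ξ : EuclideanSpace ℝ (Fin d), ENNReal.ofReal (t - symbol s ξ) =
      ENNReal.ofReal (unitVolume d s * (t ^ (d / (2 * s) + 1) / (d / (2 * s) + 1))) := by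
  have ha : (0 : ℝ) ≤ d / (2 * s) := by positivity
  have hV := unitVolume_pos d hs
  have h1 : ∀ ξ : EuclideanSpace ℝ (Fin d), ENNReal.ofReal (t - symbol s ξ) =
      ENNReal.ofReal (max (t - symbol s ξ) 0) := fun ξ => by
    rw [ENNReal.ofReal_max]; simp
  simp_rw [h1]
  rw [lintegral_eq_lintegral_meas_le (f := fun ξ => max (t - symbol s ξ) 0) volume
    (Filter.Eventually.of_forall fun ξ => le_max_right _ _)
    ((measurable_const.sub (measurable_symbol s)).max measurable_const).aemeasurable]
  have h2 : ∫⁻ r in Set.Ioi (0 : ℝ),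
      volume {ξ : EuclideanSpace ℝ (Fin d) | r ≤ max (t - symbol s ξ) 0} =
      ∫⁻ r in Set.Ioc 0 t, ENNReal.ofReal (unitVolume d s * (t - r) ^ (d / (2 * s))) := by
    rw [← lintegral_indicator measurableSet_Ioi, ← lintegral_indicator measurableSet_Ioc]
    refine lintegral_congr fun r => ?_
    by_cases hr : 0 < r
    · rw [Set.indicator_of_mem (show r ∈ Set.Ioi 0 from hr)]
      have h3 : {ξ : EuclideanSpace ℝ (Fin d) | r ≤ max (t - symbol s ξ) 0} =
          {ξ | symbol s ξ ≤ t - r} := by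
        ext ξ
        simp only [Set.mem_ofPred_eq, le_max_iff, hr.not_ge, or_false]
        constructor <;> intro h <;> linarith
      rw [h3]
      by_cases hrt : r ≤ t
      · rw [Set.indicator_of_mem (Set.mem_Ioc.2 ⟨hr, hrt⟩), volume_symbol_le hd hs (sub_nonneg.2 hrt)]
      · rw [Set.indicator_of_notMem (fun h => hrt h.2)]
        convert! measure_empty (μ := volume)
        rw [Set.eq_empty_iff_forall_notMem]
        intro ξ (hξ : symbol s ξ ≤ t - r)
        linarith [symbol_nonneg s ξ]
    · rw [Set.indicator_of_notMem (show r ∉ Set.Ioi 0 from hr),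
        Set.indicator_of_notMem (fun h => hr h.1)]
  have hcont : Continuous fun r : ℝ => unitVolume d s * (t - r) ^ (d / (2 * s)) :=
    continuous_const.mul ((continuous_const.sub continuous_id).rpow_const fun _ => Or.inr ha)
  rw [h2, ← ofReal_integral_eq_lintegral_ofReal]
  · congr 1
    rw [← intervalIntegral.integral_of_le ht, intervalIntegral.integral_const_mul,
      intervalIntegral.integral_comp_sub_left (fun x => x ^ (d / (2 * s))), sub_self, sub_zero,
      integral_rpow (Or.inl (by linarith)), Real.zero_rpow (by linarith), sub_zero]
  · exact (hcont.intervalIntegrable 0 t).1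
  · refine (ae_restrict_iff' measurableSet_Ioc).2 (Filter.Eventually.of_forall fun r hr => ?_)
    exact mul_nonneg hV.le (Real.rpow_nonneg (sub_nonneg.2 hr.2) _)

/-! ### Compactness of the weighted Fourier transform on `Ω` -/

/-- `(1 + symbol)^{-1/2}`. -/
def invWeight (s : ℝ) (ξ : EuclideanSpace ℝ (Fin d)) : ℝ := (√(1 + symbol s ξ))⁻¹

lemma invWeight_pos (s : ℝ) (ξ : EuclideanSpace ℝ (Fin d)) : 0 < invWeight s ξ := by
  have := symbol_nonneg s ξ
  unfold invWeight
  positivity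

lemma invWeight_sq (s : ℝ) (ξ : EuclideanSpace ℝ (Fin d)) :
    (1 + symbol s ξ) * invWeight s ξ ^ 2 = 1 := by
  have := symbol_nonneg s ξ
  rw [invWeight, inv_pow, Real.sq_sqrt (by positivity), mul_inv_cancel₀ (by positivity)]

lemma invWeight_bound (s : ℝ) :
    Measurable (invWeight s : EuclideanSpace ℝ (Fin d) → ℝ) ∧ ∀ ξ : EuclideanSpace ℝ (Fin d), |invWeight s ξ| ≤ 1 := by
  refine ⟨((measurable_symbol s).const_add 1).sqrt.inv, fun ξ => ?_⟩
  rw [abs_of_pos (invWeight_pos s ξ)]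
  have := invWeight_sq s ξ
  nlinarith [symbol_nonneg s ξ, invWeight_pos s ξ, sq_nonneg (invWeight s ξ)]

lemma cutoff_invWeight_bound (s t : ℝ) :
    Measurable ({ξ : EuclideanSpace ℝ (Fin d) | symbol s ξ ≤ t}.indicator (invWeight s)) ∧
      ∀ ξ, |{ξ : EuclideanSpace ℝ (Fin d) | symbol s ξ ≤ t}.indicator (invWeight s) ξ| ≤ 1 := by
  refine ⟨(invWeight_bound s).1.indicator (measurableSet_symbol_le s t), fun ξ => ?_⟩
  by_cases h : ξ ∈ {ξ : EuclideanSpace ℝ (Fin d) | symbol s ξ ≤ t}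
  · rw [Set.indicator_of_mem h]; exact (invWeight_bound s).2 ξ
  · rw [Set.indicator_of_notMem h]; simp

/-- The Fourier transform on `L²` as a bounded operator. -/
def fourierOp (d : ℕ) : L2 d →L[ℂ] L2 d :=
  (Lp.fourierTransformₗᵢ (EuclideanSpace ℝ (Fin d)) ℂ).toContinuousLinearEquiv.toContinuousLinearMap

lemma fourierOp_apply (f : L2 d) : fourierOp d f = 𝓕 f := rfl

lemma isCompactOperator_cutoff_invWeight (hd : 1 ≤ d) {s : ℝ} (hs : 1 / 2 < s) (t : ℝ)
    {Ω : Set (EuclideanSpace ℝ (Fin d))} (hΩ : MeasurableSet Ω) (hv : volume Ω < ⊤) :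
    IsCompactOperator (mulOp _ (cutoff_invWeight_bound s t) ∘L fourierOp d ∘L cutoff Ω hΩ) := by
  set D := {ξ : EuclideanSpace ℝ (Fin d) | symbol s ξ ≤ t}
  have hD : MeasurableSet D := measurableSet_symbol_le s t
  refine isCompactOperator_of_sum_norm_sq_le _ (volume Ω * volume D).toReal fun n f hf => ?_
  have h1 : ∑ i, ‖(mulOp _ (cutoff_invWeight_bound s t) ∘L fourierOp d ∘L cutoff Ω hΩ) (f i)‖ₑ ^ 2
      ≤ volume Ω * volume D := by
    simp_rw [enorm_sq_eq_lintegral]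
    rw [← lintegral_finsetSum' _ fun i _ =>
      (Lp.aestronglyMeasurable _).enorm.pow_const 2]
    calc _ ≤ ∫⁻ ξ, D.indicator (fun _ => volume Ω) ξ := by
          refine lintegral_mono_ae ?_
          filter_upwards [sum_norm_fourier_cutoff_sq_le hΩ hv hf,
            ae_all_iff.2 fun i => coeFn_mulOp _ (cutoff_invWeight_bound s t)
              (𝓕 (cutoff Ω hΩ (f i)))] with ξ hξ h2
          simp only [ContinuousLinearMap.comp_apply, fourierOp_apply, h2]
          by_cases hm : ξ ∈ D
          · rw [Set.indicator_of_mem hm, Set.indicator_of_mem hm,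
              ← ENNReal.ofReal_toReal hv.ne]
            refine le_trans ?_ (ENNReal.ofReal_le_ofReal hξ)
            rw [ENNReal.ofReal_sum_of_nonneg fun i _ => by positivity]
            refine Finset.sum_le_sum fun i _ => ?_
            rw [ENNReal.ofReal_pow (norm_nonneg _), ofReal_norm, enorm_mul]
            gcongr
            refine mul_le_of_le_one_left' ?_
            rw [← ofReal_norm, Complex.norm_real, Real.norm_eq_abs]
            simpa using ENNReal.ofReal_le_ofReal ((invWeight_bound s).2 ξ)
          · rw [Set.indicator_of_notMem hm, Set.indicator_of_notMem hm]
            simp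
      _ = volume Ω * volume D := by
          rw [lintegral_indicator_const hD]
  have h2 := ENNReal.toReal_mono
    (ENNReal.mul_ne_top hv.ne (volume_symbol_le_lt_top hd hs t).ne) h1
  rw [ENNReal.toReal_sum fun i _ => by simp] at h2
  simpa using h2

/-- The operator `(1 + symbol)^{-1/2} 𝓕 χ_Ω` is compact when `Ω` has finite volume. -/
lemma isCompactOperator_invWeight (hd : 1 ≤ d) {s : ℝ} (hs : 1 / 2 < s)
    {Ω : Set (EuclideanSpace ℝ (Fin d))} (hΩ : MeasurableSet Ω) (hv : volume Ω < ⊤) :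
    IsCompactOperator (mulOp _ (invWeight_bound s) ∘L fourierOp d ∘L cutoff Ω hΩ) := by
  have hcl := isClosed_setOfPred_isCompactOperator (σ₁₂ := RingHom.id ℂ) (M₁ := L2 d) (M₂ := L2 d)
  refine hcl.closure_subset (Metric.mem_closure_iff.2 fun ε hε => ?_)
  -- Where the symbol exceeds `(ε / 2)⁻²`, the discarded weight is at most `ε / 2`.
  refine ⟨_, isCompactOperator_cutoff_invWeight hd hs (((ε / 2) ^ 2)⁻¹) hΩ hv, ?_⟩
  rw [dist_eq_norm]
  refine lt_of_le_of_lt (ContinuousLinearMap.opNorm_le_bound _ (by positivity) fun f => ?_)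
    (half_lt_self hε)
  have h1 : ∀ g : L2 d, ‖mulOp _ (invWeight_bound s) g -
      mulOp _ (cutoff_invWeight_bound s (((ε / 2) ^ 2)⁻¹)) g‖ ≤ ε / 2 * ‖g‖ := by
    intro g
    refine Lp.norm_le_mul_norm_of_ae_le_mul ?_
    filter_upwards [coeFn_mulOp _ (invWeight_bound s) g,
      coeFn_mulOp _ (cutoff_invWeight_bound s (((ε / 2) ^ 2)⁻¹)) g,
      Lp.coeFn_sub (mulOp _ (invWeight_bound s) g)
        (mulOp _ (cutoff_invWeight_bound s (((ε / 2) ^ 2)⁻¹)) g)] with ξ h1 h2 h3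
    rw [h3, Pi.sub_apply, h1, h2]
    by_cases hm : ξ ∈ {ξ : EuclideanSpace ℝ (Fin d) | symbol s ξ ≤ ((ε / 2) ^ 2)⁻¹}
    · rw [Set.indicator_of_mem hm, sub_self, norm_zero]
      positivity
    · rw [Set.indicator_of_notMem hm, Complex.ofReal_zero, zero_mul, sub_zero, norm_mul,
        Complex.norm_real, Real.norm_eq_abs, abs_of_pos (invWeight_pos s ξ)]
      refine mul_le_mul_of_nonneg_right ?_ (norm_nonneg _)
      have hm' : ((ε / 2) ^ 2)⁻¹ < symbol s ξ := not_le.1 hm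
      refine (sq_le_sq₀ (invWeight_pos s ξ).le (by positivity)).1 ?_
      have h4 := invWeight_sq s ξ
      have h5 : ((ε / 2) ^ 2)⁻¹ * (ε / 2) ^ 2 = 1 := inv_mul_cancel₀ (by positivity)
      have h6 : ((ε / 2) ^ 2)⁻¹ * invWeight s ξ ^ 2 ≤ ((ε / 2) ^ 2)⁻¹ * (ε / 2) ^ 2 := by
        rw [h5]
        nlinarith [sq_nonneg (invWeight s ξ)]
      exact le_of_mul_le_mul_left h6 (by positivity)
  refine (h1 (𝓕 (cutoff Ω hΩ f))).trans ?_
  rw [Lp.norm_fourier_eq]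
  gcongr
  refine (norm_mulOp_le _ _ (measurable_abs_indicator_one hΩ).2 f).trans (one_mul _).le

/-! ### The energy space as an isometric image of `L²` -/

/-- The operator `(1 + ∑ᵢ (-∂ᵢ²)ˢ)^{-1/2}` read on the Fourier side in its argument. -/
def resolventSqrt (d : ℕ) (s : ℝ) : L2 d →L[ℂ] L2 d :=
  (Lp.fourierTransformₗᵢ (EuclideanSpace ℝ (Fin d)) ℂ).symm.toContinuousLinearEquiv ∘L
    mulOp _ (invWeight_bound s)

lemma fourier_resolventSqrt (s : ℝ) (g : L2 d) :
    𝓕 (resolventSqrt d s g) = mulOp _ (invWeight_bound s) g :=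
  (Lp.fourierTransformₗᵢ (EuclideanSpace ℝ (Fin d)) ℂ).apply_symm_apply _

lemma inner_resolventSqrt (s : ℝ) (f g : L2 d) :
    inner ℂ f (resolventSqrt d s g) = inner ℂ (mulOp _ (invWeight_bound s) (𝓕 f)) g := by
  rw [← Lp.inner_fourier_eq f, fourier_resolventSqrt, inner_mulOp_left]

lemma enorm_sq_add_energy (s : ℝ) (u : L2 d) :
    ‖u‖ₑ ^ 2 + energy s u =
      ∫⁻ ξ, ENNReal.ofReal (1 + symbol s ξ) * ‖(𝓕 u : L2 d) ξ‖ₑ ^ 2 := by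
  have h : ‖u‖ₑ = ‖(𝓕 u : L2 d)‖ₑ := by rw [← ofReal_norm, ← ofReal_norm, Lp.norm_fourier_eq]
  rw [h, enorm_sq_eq_lintegral, energy, ← lintegral_add_left'
    ((Lp.aestronglyMeasurable _).enorm.pow_const 2)]
  refine lintegral_congr fun ξ => ?_
  rw [ENNReal.ofReal_add zero_le_one (symbol_nonneg s ξ), add_mul, ENNReal.ofReal_one, one_mul]

/-- With `exists_resolventSqrt_eq` this makes `resolventSqrt` an isometry of `L²` onto the
finite-energy functions in the energy norm. Energy-norm closures thus become closures in `L²`. -/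
lemma enorm_sq_eq_add_energy (s : ℝ) (g : L2 d) :
    ‖g‖ₑ ^ 2 = ‖resolventSqrt d s g‖ₑ ^ 2 + energy s (resolventSqrt d s g) := by
  rw [enorm_sq_add_energy, enorm_sq_eq_lintegral]
  refine lintegral_congr_ae ?_
  filter_upwards [coeFn_mulOp _ (invWeight_bound s) g] with ξ hξ
  rw [fourier_resolventSqrt, hξ, enorm_mul, mul_pow, ← mul_assoc, ← ofReal_norm (invWeight s ξ : ℂ),
    Complex.norm_real, ← ENNReal.ofReal_pow (norm_nonneg _), Real.norm_eq_abs, sq_abs,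
    ← ENNReal.ofReal_mul (by linarith [symbol_nonneg s ξ]), invWeight_sq, ENNReal.ofReal_one,
    one_mul]

lemma form_resolventSqrt (s : ℝ) (g h : L2 d) :
    form s (resolventSqrt d s g) (resolventSqrt d s h) =
      inner ℂ h g - inner ℂ (resolventSqrt d s h) (resolventSqrt d s g) := by
  rw [← Lp.inner_fourier_eq (resolventSqrt d s h), form, fourier_resolventSqrt,
    fourier_resolventSqrt, L2.inner_def, L2.inner_def,
    ← integral_sub (L2.integrable_inner _ _) (L2.integrable_inner _ _)]
  refine integral_congr_ae ?_
  filter_upwards [coeFn_mulOp _ (invWeight_bound s) g,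
    coeFn_mulOp _ (invWeight_bound s) h] with ξ h1 h2
  have h3 : ((1 : ℂ) + symbol s ξ) * invWeight s ξ ^ 2 = 1 := by
    exact_mod_cast congrArg (fun r : ℝ => (r : ℂ)) (invWeight_sq s ξ)
  rw [h1, h2]
  simp only [RCLike.inner_apply, map_mul, Complex.conj_ofReal]
  linear_combination (g ξ * (starRingEnd ℂ) (h ξ)) * h3

lemma exists_resolventSqrt_eq (s : ℝ) {u : L2 d} (hu : energy s u < ⊤) :
    ∃ g, resolventSqrt d s g = u := by
  have hmeas : AEStronglyMeasurable
      (fun ξ => (((invWeight s ξ)⁻¹ : ℝ) : ℂ) * (𝓕 u : L2 d) ξ) volume :=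
    (Complex.measurable_ofReal.comp (invWeight_bound s).1.inv).aestronglyMeasurable.mul
      (Lp.aestronglyMeasurable _)
  have hmem : MemLp (fun ξ => (((invWeight s ξ)⁻¹ : ℝ) : ℂ) * (𝓕 u : L2 d) ξ) 2 volume := by
    refine ⟨hmeas, ?_⟩
    rw [eLpNorm_lt_top_iff_lintegral_rpow_enorm_lt_top (by norm_num) (by norm_num)]
    have h1 : ‖u‖ₑ ^ 2 + energy s u < ⊤ := by
      refine ENNReal.add_lt_top.2 ⟨?_, hu⟩
      exact ENNReal.pow_lt_top enorm_lt_top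
    rw [enorm_sq_add_energy] at h1
    refine lt_of_le_of_lt (le_of_eq (lintegral_congr fun ξ => ?_)) h1
    have h2 : 1 + symbol s ξ = ((invWeight s ξ)⁻¹) ^ 2 := by
      rw [inv_pow]
      exact eq_inv_of_mul_eq_one_left (invWeight_sq s ξ)
    rw [h2, ENNReal.toReal_ofNat, ENNReal.rpow_ofNat, enorm_mul, mul_pow, ← ofReal_norm,
      Complex.norm_real, Real.norm_eq_abs, ← ENNReal.ofReal_pow (abs_nonneg _), sq_abs]
  refine ⟨hmem.toLp _, ?_⟩
  refine (Lp.fourierTransformₗᵢ (EuclideanSpace ℝ (Fin d)) ℂ).injective ?_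
  change 𝓕 (resolventSqrt d s (hmem.toLp _)) = 𝓕 u
  rw [fourier_resolventSqrt]
  refine Lp.ext ?_
  filter_upwards [coeFn_mulOp _ (invWeight_bound s) (hmem.toLp _), hmem.coeFn_toLp] with ξ h1 h2
  rw [h1, h2, ← mul_assoc, ← Complex.ofReal_mul, mul_inv_cancel₀ (invWeight_pos s ξ).ne',
    Complex.ofReal_one, one_mul]

lemma symbol_le {s : ℝ} (hs : 0 ≤ s) (hs' : s ≤ 1) (ξ : EuclideanSpace ℝ (Fin d)) :
    symbol s ξ ≤ d * (1 + (2 * Real.pi) ^ 2 * ‖ξ‖ ^ 2) := by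
  have h : ∀ i, |2 * Real.pi * ξ i| ^ (2 * s) ≤ 1 + (2 * Real.pi) ^ 2 * ‖ξ‖ ^ 2 := by
    intro i
    have h1 : |2 * Real.pi * ξ i| ^ (2 : ℝ) ≤ (2 * Real.pi) ^ 2 * ‖ξ‖ ^ 2 := by
      rw [Real.rpow_two, sq_abs, mul_pow]
      refine mul_le_mul_of_nonneg_left ?_ (sq_nonneg _)
      rw [← sq_abs (ξ i)]
      exact pow_le_pow_left₀ (abs_nonneg _) (PiLp.norm_apply_le ξ i) 2
    rcases le_total |2 * Real.pi * ξ i| 1 with h2 | h2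
    · exact (Real.rpow_le_one (abs_nonneg _) h2 (by positivity)).trans (by
        have := Real.pi_pos
        have : 0 ≤ (2 * Real.pi) ^ 2 * ‖ξ‖ ^ 2 := by positivity
        linarith)
    · exact ((Real.rpow_le_rpow_of_exponent_le h2 (by linarith)).trans h1).trans (by linarith)
  calc symbol s ξ ≤ ∑ _i : Fin d, (1 + (2 * Real.pi) ^ 2 * ‖ξ‖ ^ 2) :=
        Finset.sum_le_sum fun i _ => h i
    _ = _ := by rw [Finset.sum_const, Finset.card_univ, Fintype.card_fin, nsmul_eq_mul]

lemma energy_toLp_lt_top {s : ℝ} (hs : 0 ≤ s) (hs' : s ≤ 1)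
    (φ : 𝓢(EuclideanSpace ℝ (Fin d), ℂ)) : energy s (φ.toLp 2 : L2 d) < ⊤ := by
  set M := ‖(𝓕 φ).toBoundedContinuousFunction‖
  have hM' : ∀ ξ, ‖(𝓕 φ) ξ‖ ≤ M := (𝓕 φ).toBoundedContinuousFunction.norm_coe_le_norm
  have hM0 : 0 ≤ M := (norm_nonneg _).trans (hM' 0)
  have hint : Integrable fun ξ => d * M * ‖(𝓕 φ) ξ‖ +
      d * M * (2 * Real.pi) ^ 2 * (‖ξ‖ ^ 2 * ‖(𝓕 φ) ξ‖) :=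
    ((𝓕 φ).integrable.norm.const_mul _).add (((𝓕 φ).integrable_pow_mul volume 2).const_mul _)
  rw [energy, toLp_fourier_eq]
  refine lt_of_le_of_lt (lintegral_mono_ae ?_) hint.lintegral_lt_top
  filter_upwards [(𝓕 φ).coeFn_toLp 2] with ξ hξ
  rw [hξ, ← ofReal_norm, ← ENNReal.ofReal_pow (norm_nonneg _),
    ← ENNReal.ofReal_mul (symbol_nonneg s ξ)]
  refine ENNReal.ofReal_le_ofReal ?_
  calc symbol s ξ * ‖(𝓕 φ) ξ‖ ^ 2
      ≤ (d * (1 + (2 * Real.pi) ^ 2 * ‖ξ‖ ^ 2)) * (M * ‖(𝓕 φ) ξ‖) := by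
        rw [sq]
        gcongr
        · exact symbol_le hs hs' ξ
        · exact hM' ξ
    _ = _ := by ring

/-! ### The Dirichlet space -/

/-- The subspace of test functions on `Ω`. -/
def testFunctions (Ω : Set (EuclideanSpace ℝ (Fin d))) : Submodule ℂ (L2 d) where
  carrier := {v | IsTestFunction Ω v}
  zero_mem' := ⟨0, by simp [HasCompactSupport.zero], by simp, by
    rw [← toLpCLM_apply (𝕜 := ℂ), map_zero]⟩
  add_mem' := by
    rintro _ _ ⟨φ, h1, h2, rfl⟩ ⟨ψ, h3, h4, rfl⟩
    refine ⟨φ + ψ, h1.add h3, (tsupport_add _ _).trans (Set.union_subset h2 h4), ?_⟩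
    simp only [← toLpCLM_apply (𝕜 := ℂ), map_add]
  smul_mem' := by
    rintro c _ ⟨φ, h1, h2, rfl⟩
    refine ⟨c • φ, h1.smul_left (f := fun _ => c), (tsupport_smul_subset_right (fun _ => c) φ).trans h2, ?_⟩
    simp only [← toLpCLM_apply (𝕜 := ℂ), map_smul]

lemma energy_lt_top_of_isTestFunction {s : ℝ} (hs : 0 ≤ s) (hs' : s ≤ 1)
    {Ω : Set (EuclideanSpace ℝ (Fin d))} {v : L2 d} (hv : IsTestFunction Ω v) :
    energy s v < ⊤ := by
  obtain ⟨φ, -, -, rfl⟩ := hv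
  exact energy_toLp_lt_top hs hs' φ

/-- The preimage under `resolventSqrt` of the space of test functions. -/
def testPreimage (s : ℝ) (Ω : Set (EuclideanSpace ℝ (Fin d))) : Submodule ℂ (L2 d) :=
  (testFunctions Ω).comap (resolventSqrt d s).toLinearMap

lemma mem_testPreimage {s : ℝ} {Ω : Set (EuclideanSpace ℝ (Fin d))} {g : L2 d} :
    g ∈ testPreimage s Ω ↔ IsTestFunction Ω (resolventSqrt d s g) := Iff.rfl

/-- The preimage under `resolventSqrt` of the energy space of the Dirichlet problem. -/
def dirichletPreimage (s : ℝ) (Ω : Set (EuclideanSpace ℝ (Fin d))) : Submodule ℂ (L2 d) :=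
  (testPreimage s Ω).topologicalClosure

lemma memDirichletSpace_resolventSqrt {s : ℝ} {Ω : Set (EuclideanSpace ℝ (Fin d))} {g : L2 d}
    (hg : g ∈ dirichletPreimage s Ω) : MemDirichletSpace s Ω (resolventSqrt d s g) := by
  intro ε hε
  obtain ⟨k, hk, hgk⟩ := EMetric.mem_closure_iff.1 hg (min ε 1) (lt_min hε zero_lt_one)
  refine ⟨resolventSqrt d s k, hk, ?_⟩
  rw [← map_sub, ← enorm_sq_eq_add_energy]
  rw [edist_eq_enorm_sub] at hgk
  calc ‖g - k‖ₑ ^ 2 = ‖g - k‖ₑ * ‖g - k‖ₑ := sq _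
    _ ≤ ‖g - k‖ₑ * 1 := by gcongr; exact hgk.le.trans (min_le_right _ _)
    _ < ε := by rw [mul_one]; exact hgk.trans_le (min_le_left _ _)

lemma exists_mem_dirichletPreimage {s : ℝ} (hs : 0 ≤ s) (hs' : s ≤ 1)
    {Ω : Set (EuclideanSpace ℝ (Fin d))} {u : L2 d} (hu : MemDirichletSpace s Ω u) :
    ∃ g ∈ dirichletPreimage s Ω, resolventSqrt d s g = u := by
  obtain ⟨v, hv, huv⟩ := hu 1 zero_lt_one
  obtain ⟨k, rfl⟩ := exists_resolventSqrt_eq s (energy_lt_top_of_isTestFunction hs hs' hv)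
  -- Finite energy is known directly only for `u - v` and for the test function `v`, so the preimage
  -- of `u` is assembled from theirs.
  obtain ⟨h, hh⟩ := exists_resolventSqrt_eq s
    (lt_of_le_of_lt le_add_self (huv.trans ENNReal.one_lt_top))
  have hu' : resolventSqrt d s (h + k) = u := by rw [map_add, hh, sub_add_cancel]
  refine ⟨h + k, EMetric.mem_closure_iff.2 fun ε hε => ?_, hu'⟩
  obtain ⟨v', hv', huv'⟩ := hu (ε ^ 2) (by positivity)
  obtain ⟨k', rfl⟩ := exists_resolventSqrt_eq s (energy_lt_top_of_isTestFunction hs hs' hv')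
  refine ⟨k', hv', ?_⟩
  rw [← hu', ← map_sub, ← enorm_sq_eq_add_energy] at huv'
  rw [edist_eq_enorm_sub]
  exact lt_of_pow_lt_pow_left' 2 huv'

lemma cutoff_isTestFunction {Ω : Set (EuclideanSpace ℝ (Fin d))} (hΩ : MeasurableSet Ω)
    {v : L2 d} (hv : IsTestFunction Ω v) : cutoff Ω hΩ v = v := by
  obtain ⟨φ, -, h, rfl⟩ := hv
  refine Lp.ext ?_
  filter_upwards [coeFn_cutoff hΩ (φ.toLp 2 : L2 d), φ.coeFn_toLp 2] with x h1 h2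
  rw [h1]
  by_cases hx : x ∈ Ω
  · rw [Set.indicator_of_mem hx]
  · rw [Set.indicator_of_notMem hx, h2, image_eq_zero_of_notMem_tsupport fun h' => hx (h h')]

lemma cutoff_resolventSqrt {s : ℝ} {Ω : Set (EuclideanSpace ℝ (Fin d))} (hΩ : MeasurableSet Ω)
    {g : L2 d} (hg : g ∈ dirichletPreimage s Ω) :
    cutoff Ω hΩ (resolventSqrt d s g) = resolventSqrt d s g := by
  have hcl : IsClosed {g : L2 d | cutoff Ω hΩ (resolventSqrt d s g) = resolventSqrt d s g} :=
    isClosed_eq (by fun_prop) (by fun_prop)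
  exact closure_minimal (fun k hk => cutoff_isTestFunction hΩ (mem_testPreimage.1 hk)) hcl hg

/-- The weak eigenvalue equation extends from test functions to the energy space. -/
lemma IsDirichletEigenfunction.form_eq {s : ℝ} (hs : 0 ≤ s) (hs' : s ≤ 1)
    {Ω : Set (EuclideanSpace ℝ (Fin d))} {E : ℝ} {u : L2 d}
    (hu : IsDirichletEigenfunction s Ω E u) {v : L2 d} (hv : MemDirichletSpace s Ω v) :
    form s u v = E * inner ℂ v u := by
  obtain ⟨g, hg, rfl⟩ := exists_mem_dirichletPreimage hs hs' hu.2.1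
  obtain ⟨h, hh, rfl⟩ := exists_mem_dirichletPreimage hs hs' hv
  have hcl : IsClosed {h : L2 d | inner ℂ h g - inner ℂ (resolventSqrt d s h) (resolventSqrt d s g)
      = (E : ℂ) * inner ℂ (resolventSqrt d s h) (resolventSqrt d s g)} :=
    isClosed_eq (by fun_prop) (by fun_prop)
  rw [form_resolventSqrt]
  refine closure_minimal (fun k hk => ?_) hcl hh
  have := hu.2.2 _ (mem_testPreimage.1 hk)
  rwa [form_resolventSqrt] at this

instance (s : ℝ) (Ω : Set (EuclideanSpace ℝ (Fin d))) : CompleteSpace (dirichletPreimage s Ω) :=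
  (testPreimage s Ω).isClosed_topologicalClosure.completeSpace_coe

/-! ### The Green operator and its spectrum -/

/-- The Green operator `(1 + ∑ᵢ (-∂ᵢ²)ˢ)⁻¹` of the Dirichlet problem in `Ω`. -/
def greenOp (s : ℝ) (Ω : Set (EuclideanSpace ℝ (Fin d))) : L2 d →L[ℂ] L2 d :=
  resolventSqrt d s ∘L (dirichletPreimage s Ω).starProjection ∘L
    mulOp _ (invWeight_bound s) ∘L fourierOp d

lemma greenOp_apply (s : ℝ) (Ω : Set (EuclideanSpace ℝ (Fin d))) (f : L2 d) :
    greenOp s Ω f = resolventSqrt d s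
      ((dirichletPreimage s Ω).starProjection (mulOp _ (invWeight_bound s) (𝓕 f))) := rfl

/-- What the cutoff removes is orthogonal to functions vanishing off `Ω`, hence is killed by the
projection. This brings in the finite volume of `Ω`, from which compactness follows. -/
lemma greenOp_eq_comp_cutoff (s : ℝ) {Ω : Set (EuclideanSpace ℝ (Fin d))}
    (hΩ : MeasurableSet Ω) :
    greenOp s Ω = (resolventSqrt d s ∘L (dirichletPreimage s Ω).starProjection) ∘L
      (mulOp _ (invWeight_bound s) ∘L fourierOp d ∘L cutoff Ω hΩ) := by
  ext1 f
  simp only [greenOp_apply, ContinuousLinearMap.comp_apply, fourierOp_apply]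
  congr 1
  rw [← sub_eq_zero, ← map_sub, Submodule.starProjection_apply_eq_zero_iff,
    Submodule.mem_orthogonal]
  intro k hk
  rw [inner_sub_right, ← inner_mulOp_left, ← inner_mulOp_left, sub_eq_zero,
    ← fourier_resolventSqrt, Lp.inner_fourier_eq, Lp.inner_fourier_eq,
    ← inner_cutoff_left, cutoff_resolventSqrt hΩ hk]

lemma isCompactOperator_greenOp (hd : 1 ≤ d) {s : ℝ} (hs : 1 / 2 < s)
    {Ω : Set (EuclideanSpace ℝ (Fin d))} (hΩ : MeasurableSet Ω) (hv : volume Ω < ⊤) :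
    IsCompactOperator (greenOp s Ω) := by
  rw [greenOp_eq_comp_cutoff s hΩ]
  exact (isCompactOperator_invWeight hd hs hΩ hv).clm_comp
    (resolventSqrt d s ∘L (dirichletPreimage s Ω).starProjection)

lemma inner_greenOp (s : ℝ) (Ω : Set (EuclideanSpace ℝ (Fin d))) (f g : L2 d) :
    inner ℂ f (greenOp s Ω g) = inner ℂ (mulOp _ (invWeight_bound s) (𝓕 f))
      ((dirichletPreimage s Ω).starProjection (mulOp _ (invWeight_bound s) (𝓕 g))) := by
  rw [greenOp_apply, inner_resolventSqrt]

lemma isSymmetric_greenOp (s : ℝ) (Ω : Set (EuclideanSpace ℝ (Fin d))) :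
    (greenOp s Ω).toLinearMap.IsSymmetric := by
  intro f g
  change inner ℂ (greenOp s Ω f) g = inner ℂ f (greenOp s Ω g)
  rw [← inner_conj_symm, inner_greenOp, inner_greenOp, inner_conj_symm,
    Submodule.inner_starProjection_left_eq_right]

lemma isDirichletEigenfunction_of_greenOp_eq {s : ℝ} (hs : 0 ≤ s) (hs' : s ≤ 1)
    {Ω : Set (EuclideanSpace ℝ (Fin d))} {f : L2 d} (hf : f ≠ 0) {l : ℂ} (hl : l ≠ 0)
    (h : greenOp s Ω f = l • f) : ∃ E : ℝ, IsDirichletEigenfunction s Ω E f := by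
  have hreal : (starRingEnd ℂ) l = l :=
    (isSymmetric_greenOp s Ω).conj_eigenvalue_eq_self
      (Module.End.hasEigenvalue_of_hasEigenvector
        ⟨Module.End.mem_eigenspace_iff.2 h, hf⟩)
  have hl' : ((l.re : ℝ) : ℂ) = l := Complex.conj_eq_iff_re.1 hreal
  set p := (dirichletPreimage s Ω).starProjection (mulOp _ (invWeight_bound s) (𝓕 f)) with hp
  set g := l⁻¹ • p with hg
  have hgK : g ∈ dirichletPreimage s Ω :=
    Submodule.smul_mem _ _ (Submodule.starProjection_apply_mem _ _)
  have hBg : resolventSqrt d s g = f := by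
    rw [hg, map_smul, hp, ← greenOp_apply, h, smul_smul, inv_mul_cancel₀ hl, one_smul]
  -- The Green operator inverts `1 + ∑ᵢ (-∂ᵢ²)ˢ`, so its eigenvalue `l` corresponds to `1 + E =
  -- l⁻¹`; `l` is real by symmetry.
  refine ⟨l.re⁻¹ - 1, hf, hBg ▸ memDirichletSpace_resolventSqrt hgK, fun v hv => ?_⟩
  obtain ⟨k, rfl⟩ := exists_resolventSqrt_eq s (energy_lt_top_of_isTestFunction hs hs' hv)
  have hk : k ∈ dirichletPreimage s Ω :=
    (testPreimage s Ω).le_topologicalClosure (mem_testPreimage.2 hv)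
  have h1 : inner ℂ k g = l⁻¹ * inner ℂ (resolventSqrt d s k) f := by
    rw [hg, inner_smul_right, hp, ← Submodule.inner_starProjection_left_eq_right,
      Submodule.starProjection_eq_self_iff.2 hk, ← inner_mulOp_left, ← fourier_resolventSqrt,
      Lp.inner_fourier_eq]
  conv_lhs => rw [← hBg]
  rw [form_resolventSqrt, h1, hBg]
  push_cast
  rw [hl']
  ring

/-- A nonempty open set in positive dimension carries arbitrarily many linearly independent test
functions. -/
lemma exists_linearIndependent_isTestFunction (hd : 1 ≤ d) {Ω : Set (EuclideanSpace ℝ (Fin d))}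
    (hΩ : IsOpen Ω) (hne : Ω.Nonempty) (n : ℕ) :
    ∃ f : Fin n → L2 d, LinearIndependent ℂ f ∧ ∀ i, IsTestFunction Ω (f i) := by
  obtain ⟨x₀, hx₀⟩ := hne
  have : Nonempty (Fin d) := ⟨⟨0, hd⟩⟩
  have hinf : Ω.Infinite := infinite_of_mem_nhds x₀ (hΩ.mem_nhds hx₀)
  let x : Fin n → EuclideanSpace ℝ (Fin d) := fun i => hinf.natEmbedding Ω i
  have hx : Function.Injective x := fun i j h =>
    Fin.ext ((hinf.natEmbedding Ω).injective (Subtype.ext h))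
  have hxΩ : ∀ i, x i ∈ Ω := fun i => (hinf.natEmbedding Ω i).2
  obtain ⟨U, hU, hdisj⟩ := (Set.finite_range x).t2_separation
  have hbump : ∀ i, ∃ φ : 𝓢(EuclideanSpace ℝ (Fin d), ℂ),
      HasCompactSupport φ ∧ tsupport φ ⊆ Ω ∩ U (x i) ∧ φ (x i) = 1 := by
    intro i
    obtain ⟨f, h1, h2, h3, -, h5⟩ := exists_contDiff_tsupport_subset (n := (⊤ : ℕ∞))
      ((hΩ.inter (hU (x i)).2).mem_nhds ⟨hxΩ i, (hU (x i)).1⟩)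
    have h2' : HasCompactSupport (Complex.ofRealCLM ∘ f) := h2.comp_left (by simp)
    have h4 : tsupport (Complex.ofRealCLM ∘ f) ⊆ tsupport f :=
      closure_mono (Function.support_comp_subset (map_zero _) f)
    refine ⟨h2'.toSchwartzMap (Complex.ofRealCLM.contDiff.comp h3), h2', h4.trans h1, ?_⟩
    change ((f (x i) : ℝ) : ℂ) = 1
    rw [h5, Complex.ofReal_one]
  choose φ hφ1 hφ2 hφ3 using hbump
  refine ⟨fun i => (φ i).toLp 2, ?_, fun i => ⟨φ i, hφ1 i,
    (hφ2 i).trans Set.inter_subset_left, rfl⟩⟩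
  refine linearIndependent_of_ne_zero_of_inner_eq_zero (fun i h => ?_) fun i j hij => ?_
  · have h0 : φ i = 0 := by
      refine SchwartzMap.injective_toLp (p := 2) (μ := volume) ?_
      change (φ i).toLp 2 = (0 : 𝓢(EuclideanSpace ℝ (Fin d), ℂ)).toLp 2
      rw [h, ← toLpCLM_apply (𝕜 := ℂ), map_zero]
    have := hφ3 i
    rw [h0] at this
    simp at this
  · change inner ℂ _ _ = (0 : ℂ)
    rw [L2.inner_def]
    refine integral_eq_zero_of_ae ?_
    filter_upwards [(φ i).coeFn_toLp 2, (φ j).coeFn_toLp 2] with y h1 h2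
    rw [h1, h2]
    by_cases hy : y ∈ U (x i)
    · have : y ∉ tsupport (φ j) := fun h' =>
        (Set.disjoint_left.1 (hdisj ⟨i, rfl⟩ ⟨j, rfl⟩ (hx.ne hij))) hy (hφ2 j h').2
      rw [image_eq_zero_of_notMem_tsupport this]
      simp
    · rw [image_eq_zero_of_notMem_tsupport fun h' => hy (hφ2 i h').2]
      simp

/-- The Dirichlet problem has infinitely many eigenvalues. -/
lemma exists_hasEigenvaluesBelow (hd : 1 ≤ d) {s : ℝ} (hs : 1 / 2 < s) (hs' : s ≤ 1)
    {Ω : Set (EuclideanSpace ℝ (Fin d))} (hΩ : IsOpen Ω) (hne : Ω.Nonempty)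
    (hv : volume Ω < ⊤) (n : ℕ) : ∃ t, HasEigenvaluesBelow s Ω n t := by
  have hs0 : 0 ≤ s := by linarith
  set S : Set (L2 d) := {f | f ≠ 0 ∧ ∃ l : ℂ, l ≠ 0 ∧ greenOp s Ω f = l • f} with hS
  obtain ⟨b, hbS, hspan, hb⟩ := exists_linearIndependent ℂ S
  have hinf : b.Infinite := by
    intro hfin
    have hV : FiniteDimensional ℂ (Submodule.span ℂ S) := by
      rw [← hspan]
      exact FiniteDimensional.span_of_finite ℂ hfin
    set V := Submodule.span ℂ S with hVdef
    -- The defect `v - V.starProjection v` is orthogonal to every eigenspace, including the kernel,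
    -- so the spectral theorem makes it zero.
    have hle : testFunctions Ω ≤ V := by
      intro v hv'
      obtain ⟨k, rfl⟩ := exists_resolventSqrt_eq s (energy_lt_top_of_isTestFunction hs0 hs' hv')
      have hk : k ∈ dirichletPreimage s Ω :=
        (testPreimage s Ω).le_topologicalClosure (mem_testPreimage.2 hv')
      set v := resolventSqrt d s k with hvk
      have hzero : v - V.starProjection v ∈
          (⨆ μ, Module.End.eigenspace (greenOp s Ω).toLinearMap μ)ᗮ := by
        rw [← Submodule.iInf_orthogonal, Submodule.mem_iInf]
        intro μ
        rw [Submodule.mem_orthogonal]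
        intro f hf
        have hf' : greenOp s Ω f = μ • f := Module.End.mem_eigenspace_iff.1 hf
        rcases eq_or_ne μ 0 with rfl | hμ
        · rw [zero_smul] at hf'
          set p := (dirichletPreimage s Ω).starProjection (mulOp _ (invWeight_bound s) (𝓕 f))
            with hp
          -- The quadratic form of the Green operator at `f` is `‖p‖²`, so a kernel vector has `p =
          -- 0` and is orthogonal to every test function.
          have hp0 : p = 0 := by
            have h1 := inner_greenOp s Ω f f
            rw [hf', inner_zero_right, ← hp] at h1
            have h2 : inner ℂ p p = 0 := by
              conv_lhs => rw [hp]
              rw [Submodule.inner_starProjection_left_eq_right,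
                Submodule.starProjection_eq_self_iff.2 (Submodule.starProjection_apply_mem _ _),
                ← h1]
            exact inner_self_eq_zero.1 h2
          have h1 : inner ℂ f v = 0 := by
            rw [hvk, inner_resolventSqrt, ← Submodule.starProjection_eq_self_iff.2 hk,
              ← Submodule.inner_starProjection_left_eq_right, ← hp, hp0, inner_zero_left]
          have h2 : V ≤ (ℂ ∙ f)ᗮ := by
            rw [hVdef, Submodule.span_le]
            rintro g ⟨-, l, hl, hg⟩
            rw [SetLike.mem_coe, Submodule.mem_orthogonal_singleton_iff_inner_right]
            have h3 : inner ℂ (greenOp s Ω f) g = inner ℂ f (greenOp s Ω g) :=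
              isSymmetric_greenOp s Ω f g
            rw [hf', hg, inner_zero_left, inner_smul_right] at h3
            exact (mul_eq_zero.1 h3.symm).resolve_left hl
          rw [inner_sub_right, h1, zero_sub, neg_eq_zero]
          exact Submodule.mem_orthogonal_singleton_iff_inner_right.1
            (h2 (Submodule.starProjection_apply_mem _ _))
        · rcases eq_or_ne f 0 with rfl | hf0
          · simp
          · exact (Submodule.mem_orthogonal _ _).1 (V.sub_starProjection_mem_orthogonal v) f
              (Submodule.subset_span ⟨hf0, μ, hμ, hf'⟩)
      rw [ContinuousLinearMap.orthogonalComplement_iSup_eigenspaces_eq_bot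
        (isCompactOperator_greenOp hd hs hΩ.measurableSet hv) (isSymmetric_greenOp s Ω),
        Submodule.mem_bot, sub_eq_zero] at hzero
      rw [hzero]
      exact Submodule.starProjection_apply_mem _ _
    obtain ⟨f, hf, hfΩ⟩ := exists_linearIndependent_isTestFunction hd hΩ hne
      (Module.finrank ℂ V + 1)
    have h1 : LinearIndependent ℂ (fun i => (⟨f i, hle (hfΩ i)⟩ : V)) :=
      LinearIndependent.of_comp V.subtype hf
    have := h1.fintype_card_le_finrank
    simp at this
  have : Infinite b := hinf.to_subtype
  have hE : ∀ x : b, ∃ E : ℝ, IsDirichletEigenfunction s Ω E x := fun x => by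
    obtain ⟨h1, l, hl, h2⟩ := hbS x.2
    exact isDirichletEigenfunction_of_greenOp_eq hs0 hs' h1 hl h2
  choose E hE using hE
  let e : Fin n → b := fun i => Infinite.natEmbedding b i
  have he : Function.Injective e := fun i j h =>
    Fin.ext ((Infinite.natEmbedding b).injective h)
  exact ⟨∑ i, |E (e i)|, fun i => e i, hb.comp e he, fun i => ⟨E (e i),
    (le_abs_self _).trans (Finset.single_le_sum (f := fun i => |E (e i)|)
      (fun _ _ => abs_nonneg _) (Finset.mem_univ i)), hE _⟩⟩

/-! ### The Berezin–Li–Yau inequality -/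

/-- Integrate the pointwise bound `t F ≤ symbol * F + |Ω| (t - symbol)₊`, valid because `0 ≤ F ≤
|Ω|`. Working in `ℝ≥0∞` avoids integrability conditions. -/
lemma ofReal_mul_card_le_sum_energy (hd : 1 ≤ d) {s : ℝ} (hs : 1 / 2 < s)
    {Ω : Set (EuclideanSpace ℝ (Fin d))} (hΩ : MeasurableSet Ω) (hv : volume Ω < ⊤) {N : ℕ}
    {u : Fin N → L2 d} (hu : Orthonormal ℂ u) (huΩ : ∀ i, cutoff Ω hΩ (u i) = u i)
    {t : ℝ} (ht : 0 ≤ t) :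
    ENNReal.ofReal t * N ≤ ∑ i, energy s (u i) +
      volume Ω * ENNReal.ofReal
        (unitVolume d s * (t ^ (d / (2 * s) + 1) / (d / (2 * s) + 1))) := by
  have hmeas : ∀ i, AEMeasurable (fun ξ => ‖(𝓕 (u i) : L2 d) ξ‖ₑ ^ 2) volume := fun i =>
    (Lp.aestronglyMeasurable _).enorm.pow_const 2
  have hsymb : Measurable fun ξ : EuclideanSpace ℝ (Fin d) => ENNReal.ofReal (symbol s ξ) :=
    (measurable_symbol s).ennreal_ofReal
  have hF : ∫⁻ ξ, ∑ i, ‖(𝓕 (u i) : L2 d) ξ‖ₑ ^ 2 = N := by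
    rw [lintegral_finsetSum' _ fun i _ => hmeas i]
    have : ∀ i, ∫⁻ ξ, ‖(𝓕 (u i) : L2 d) ξ‖ₑ ^ 2 = 1 := fun i => by
      rw [← enorm_sq_eq_lintegral, ← ofReal_norm, Lp.norm_fourier_eq, hu.1 i]
      simp
    simp [this]
  have hE : ∑ i, energy s (u i) =
      ∫⁻ ξ, ENNReal.ofReal (symbol s ξ) * ∑ i, ‖(𝓕 (u i) : L2 d) ξ‖ₑ ^ 2 := by
    simp_rw [Finset.mul_sum]
    have h : ∀ i, AEMeasurable
        (fun ξ => ENNReal.ofReal (symbol s ξ) * ‖(𝓕 (u i) : L2 d) ξ‖ₑ ^ 2) volume :=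
      fun i => hsymb.aemeasurable.mul (hmeas i)
    rw [lintegral_finsetSum' _ fun i _ => h i]
    rfl
  have hmeasF : AEMeasurable (fun ξ => ∑ i, ‖(𝓕 (u i) : L2 d) ξ‖ₑ ^ 2) volume :=
    Finset.aemeasurable_fun_sum _ fun i _ => hmeas i
  have hmeasE : AEMeasurable (fun ξ => ENNReal.ofReal (symbol s ξ) *
      ∑ i, ‖(𝓕 (u i) : L2 d) ξ‖ₑ ^ 2) volume := hsymb.aemeasurable.mul hmeasF
  rw [← lintegral_sub_symbol hd hs ht, ← hF, hE, ← lintegral_const_mul'' _ hmeasF,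
    ← lintegral_const_mul' _ _ hv.ne, ← lintegral_add_left' hmeasE]
  refine lintegral_mono_ae ?_
  filter_upwards [sum_norm_fourier_cutoff_sq_le hΩ hv hu] with ξ hξ
  simp only [huΩ] at hξ
  have hle : ∑ i, ‖(𝓕 (u i) : L2 d) ξ‖ₑ ^ 2 ≤ volume Ω := by
    rw [← ENNReal.ofReal_toReal hv.ne]
    refine le_trans (le_of_eq ?_) (ENNReal.ofReal_le_ofReal hξ)
    rw [ENNReal.ofReal_sum_of_nonneg fun i _ => by positivity]
    refine Finset.sum_congr rfl fun i _ => ?_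
    rw [ENNReal.ofReal_pow (norm_nonneg _), ofReal_norm]
  calc ENNReal.ofReal t * ∑ i, ‖(𝓕 (u i) : L2 d) ξ‖ₑ ^ 2
      ≤ (ENNReal.ofReal (symbol s ξ) + ENNReal.ofReal (t - symbol s ξ)) *
        ∑ i, ‖(𝓕 (u i) : L2 d) ξ‖ₑ ^ 2 := by
        gcongr
        refine le_trans (le_of_eq ?_) ENNReal.ofReal_add_le
        rw [add_sub_cancel]
    _ ≤ ENNReal.ofReal (symbol s ξ) * ∑ i, ‖(𝓕 (u i) : L2 d) ξ‖ₑ ^ 2 +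
        volume Ω * ENNReal.ofReal (t - symbol s ξ) := by
        rw [add_mul, mul_comm (volume Ω)]
        gcongr

/-- The Berezin–Li–Yau inequality with a free spectral parameter `t`. -/
lemma mul_card_le_sum_energy_toReal (hd : 1 ≤ d) {s : ℝ} (hs : 1 / 2 < s)
    {Ω : Set (EuclideanSpace ℝ (Fin d))} (hΩ : MeasurableSet Ω) (hv : volume Ω < ⊤) {N : ℕ}
    {u : Fin N → L2 d} (hu : Orthonormal ℂ u) (huΩ : ∀ i, cutoff Ω hΩ (u i) = u i)
    (hE : ∀ i, energy s (u i) < ⊤) {t : ℝ} (ht : 0 ≤ t) :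
    t * N ≤ ∑ i, (energy s (u i)).toReal + (volume Ω).toReal *
      (unitVolume d s * (t ^ (d / (2 * s) + 1) / (d / (2 * s) + 1))) := by
  have h := ofReal_mul_card_le_sum_energy hd hs hΩ hv hu huΩ ht
  have hV := unitVolume_pos d hs
  have hE' : ∑ i, energy s (u i) ≠ ⊤ := (ENNReal.sum_lt_top.2 fun i _ => hE i).ne
  have hM := ENNReal.mul_ne_top hv.ne (ENNReal.ofReal_ne_top
    (r := unitVolume d s * (t ^ (d / (2 * s) + 1) / (d / (2 * s) + 1))))
  have h' := ENNReal.toReal_mono (ENNReal.add_ne_top.2 ⟨hE', hM⟩) h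
  rw [ENNReal.toReal_add hE' hM, ENNReal.toReal_mul, ENNReal.toReal_mul,
    ENNReal.toReal_ofReal ht, ENNReal.toReal_ofReal (by positivity),
    ENNReal.toReal_sum fun i _ => (hE i).ne] at h'
  simpa using h'

lemma unitVolume_eq (hd : 1 ≤ d) {s : ℝ} (hs : 1 / 2 < s) :
    unitVolume d s = (2 * Real.pi)⁻¹ ^ d * (sphereVolume d s / d) := by
  have hd0 : (d : ℝ) ≠ 0 := by positivity
  have hs0 : 2 * s ≠ 0 := by positivity
  have hG : Real.Gamma (d / (2 * s)) ≠ 0 :=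
    (Real.Gamma_pos_of_pos (by positivity)).ne'
  rw [unitVolume, sphereVolume, Real.Gamma_add_one (div_ne_zero hd0 hs0),
    add_comm (1 / (2 * s)) 1]
  field_simp

/-- The Berezin–Li–Yau inequality for orthonormal systems. -/
lemma le_sum_energy_toReal (hd : 1 ≤ d) {s : ℝ} (hs : 1 / 2 < s)
    {Ω : Set (EuclideanSpace ℝ (Fin d))} (hΩ : MeasurableSet Ω) (hv : volume Ω < ⊤)
    (hv0 : 0 < volume Ω) {N : ℕ}
    {u : Fin N → L2 d} (hu : Orthonormal ℂ u) (huΩ : ∀ i, cutoff Ω hΩ (u i) = u i)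
    (hE : ∀ i, energy s (u i) < ⊤) :
    (2 * Real.pi) ^ (2 * s) * ((d : ℝ) / ((d : ℝ) + 2 * s)) *
        ((d : ℝ) / (sphereVolume d s * (volume Ω).toReal)) ^ (2 * s / (d : ℝ)) *
        (N : ℝ) ^ (1 + 2 * s / (d : ℝ)) ≤ ∑ i, (energy s (u i)).toReal := by
  have hM : 0 < (volume Ω).toReal := ENNReal.toReal_pos hv0.ne' hv.ne
  have hV := unitVolume_pos d hs
  have hd0 : (0 : ℝ) < d := by positivity
  have hs0 : 0 < 2 * s := by positivity
  have hpi := Real.pi_pos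
  have hA : 0 < sphereVolume d s := by
    have h1 := unitVolume_eq hd hs
    by_contra! h2
    have : (2 * Real.pi)⁻¹ ^ d * (sphereVolume d s / d) ≤ 0 :=
      mul_nonpos_of_nonneg_of_nonpos (by positivity) (div_nonpos_of_nonpos_of_nonneg h2 hd0.le)
    linarith
  set M := (volume Ω).toReal
  set A := sphereVolume d s
  set κ := unitVolume d s with hκ
  set a : ℝ := d / (2 * s) with ha
  have ha0 : 0 < a := by positivity
  have hinv : 2 * s / d = a⁻¹ := by rw [ha, inv_div]
  -- The maximiser of `t N - M κ t^(a+1) / (a+1)`, where `M κ t^a = N`.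
  set t : ℝ := (N / (M * κ)) ^ (2 * s / (d : ℝ)) with ht
  have ht0 : 0 ≤ t := by positivity
  have hta : t ^ a = N / (M * κ) := by
    rw [ht, hinv, ← Real.rpow_mul (by positivity), inv_mul_cancel₀ ha0.ne', Real.rpow_one]
  have hmain := mul_card_le_sum_energy_toReal hd hs hΩ hv hu huΩ hE ht0
  have h1 : M * (κ * (t ^ (a + 1) / (a + 1))) = t * N / (a + 1) := by
    rw [Real.rpow_add_of_nonneg ht0 ha0.le zero_le_one, Real.rpow_one, hta]
    field_simp
  rw [← ha, ← hκ, h1] at hmain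
  have h2 : t = (2 * Real.pi) ^ (2 * s) * (d / (A * M)) ^ (2 * s / (d : ℝ)) *
      (N : ℝ) ^ (2 * s / (d : ℝ)) := by
    have h3 : (N : ℝ) / (M * κ) = (2 * Real.pi) ^ (d : ℝ) * (d / (A * M)) * N := by
      have h5 : κ = (2 * Real.pi)⁻¹ ^ d * (A / d) := unitVolume_eq hd hs
      rw [h5, Real.rpow_natCast, inv_pow]
      field_simp
    rw [ht, h3, Real.mul_rpow (by positivity) (by positivity),
      Real.mul_rpow (by positivity) (by positivity), ← Real.rpow_mul (by positivity),
      mul_div_cancel₀ _ hd0.ne']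
  have h4 : (d : ℝ) / (d + 2 * s) = 1 - 1 / (a + 1) := by
    rw [ha]
    field_simp
    ring
  rw [Real.rpow_add_of_nonneg (Nat.cast_nonneg N) zero_le_one (by positivity), Real.rpow_one, h4]
  calc _ = t * N - t * N / (a + 1) := by rw [h2]; ring
    _ ≤ _ := by linarith

/-! ### From eigenvalues to orthonormal systems -/

lemma norm_sq_eq_add_energy_toReal (s : ℝ) (g : L2 d) :
    ‖g‖ ^ 2 = ‖resolventSqrt d s g‖ ^ 2 + (energy s (resolventSqrt d s g)).toReal ∧
      energy s (resolventSqrt d s g) < ⊤ := by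
  have h := enorm_sq_eq_add_energy s g
  have hlt : energy s (resolventSqrt d s g) < ⊤ := by
    refine lt_of_le_of_lt le_add_self (h ▸ ENNReal.pow_lt_top enorm_lt_top)
  refine ⟨?_, hlt⟩
  have h' := congrArg ENNReal.toReal h
  rw [ENNReal.toReal_add (ENNReal.pow_lt_top enorm_lt_top).ne hlt.ne] at h'
  simpa using h'

/-- On the span of eigenfunctions with eigenvalues at most `t` the energy is at most `t`. -/
lemma energy_le_of_mem_span {s : ℝ} (hs : 0 ≤ s) (hs' : s ≤ 1)
    {Ω : Set (EuclideanSpace ℝ (Fin d))} {ι : Type*} [Fintype ι] {t : ℝ} {f : ι → L2 d}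
    (hf : ∀ i, ∃ E : ℝ, E ≤ t ∧ IsDirichletEigenfunction s Ω E (f i)) {u : L2 d}
    (hu : u ∈ Submodule.span ℂ (Set.range f)) :
    MemDirichletSpace s Ω u ∧ energy s u < ⊤ ∧ (energy s u).toReal ≤ t * ‖u‖ ^ 2 := by
  choose E hEt hE using hf
  choose g hgK hgf using fun i => exists_mem_dirichletPreimage hs hs' (hE i).2.1
  obtain ⟨c, rfl⟩ := (Submodule.mem_span_range_iff_exists_fun ℂ).1 hu
  have hBg : resolventSqrt d s (∑ i, c i • g i) = ∑ i, c i • f i := by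
    simp only [map_sum, map_smul, hgf]
  have hmem : ∑ i, c i • g i ∈ dirichletPreimage s Ω :=
    Submodule.sum_mem _ fun i _ => Submodule.smul_mem _ _ (hgK i)
  have hinner : ∀ i j, inner ℂ (g j) (g i) = (1 + E i : ℂ) * inner ℂ (f j) (f i) := by
    intro i j
    have h := (hE i).form_eq hs hs' (hE j).2.1
    rw [← hgf i, ← hgf j, form_resolventSqrt, hgf, hgf] at h
    linear_combination h
  have horth : ∀ i j, inner ℂ (f j) (f i) = 0 ∨ E i = E j := by
    intro i j
    have h1 := hinner i j
    have h2 := congrArg (starRingEnd ℂ) (hinner j i)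
    simp only [map_mul, inner_conj_symm, map_add, map_one, Complex.conj_ofReal] at h2
    have h3 : ((E i : ℂ) - E j) * inner ℂ (f j) (f i) = 0 := by
      rw [h1] at h2
      linear_combination h2
    rcases mul_eq_zero.1 h3 with h4 | h4
    · right; exact_mod_cast sub_eq_zero.1 h4
    · left; exact h4
  -- The `f i` need not be orthogonal within an eigenspace. Instead of diagonalising, `t ‖u‖² -
  -- energy` is written as the squared norm of one vector; cross terms with `E i ≠ E j` vanish.
  have hkey : inner ℂ (∑ i, (√(t - E i) : ℂ) • c i • f i) (∑ i, (√(t - E i) : ℂ) • c i • f i) =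
      (t + 1 : ℂ) * inner ℂ (∑ i, c i • f i) (∑ i, c i • f i) -
        inner ℂ (∑ i, c i • g i) (∑ i, c i • g i) := by
    simp only [sum_inner, inner_sum, inner_smul_left, inner_smul_right, Finset.mul_sum,
      ← Finset.sum_sub_distrib, hinner, Complex.conj_ofReal]
    refine Finset.sum_congr rfl fun i _ => Finset.sum_congr rfl fun j _ => ?_
    rcases horth i j with h | h
    · rw [h]; ring
    · have h5 : (√(t - E j) : ℂ) * √(t - E j) = t - E j := by
        rw [← Complex.ofReal_mul, Real.mul_self_sqrt (sub_nonneg.2 (hEt j))]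
        push_cast
        rfl
      rw [h]
      linear_combination (c i * (starRingEnd ℂ) (c j) * inner ℂ (f j) (f i)) * h5
  obtain ⟨h6, h7⟩ := norm_sq_eq_add_energy_toReal s (∑ i, c i • g i)
  rw [hBg] at h6 h7
  refine ⟨hBg ▸ memDirichletSpace_resolventSqrt hmem, h7, ?_⟩
  rw [inner_self_eq_norm_sq_to_K, inner_self_eq_norm_sq_to_K, inner_self_eq_norm_sq_to_K] at hkey
  have h9 : ‖∑ i, (√(t - E i) : ℂ) • c i • f i‖ ^ 2 =
      (t + 1) * ‖∑ i, c i • f i‖ ^ 2 - ‖∑ i, c i • g i‖ ^ 2 := by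
    apply Complex.ofReal_injective
    simp only [Complex.ofReal_sub, Complex.ofReal_mul, Complex.ofReal_add, Complex.ofReal_one,
      Complex.ofReal_pow]
    exact hkey
  nlinarith [sq_nonneg ‖∑ i, (√(t - E i) : ℂ) • c i • f i‖]

/-- A subspace of dimension larger than `n` contains a unit vector orthogonal to `n` given
vectors. -/
lemma exists_norm_eq_one_inner_eq_zero {H : Type*} [NormedAddCommGroup H] [InnerProductSpace ℂ H]
    {n : ℕ} (u : Fin n → H) (V : Submodule ℂ H) [FiniteDimensional ℂ V]
    (hV : n < Module.finrank ℂ V) :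
    ∃ x ∈ V, ‖x‖ = 1 ∧ ∀ i, inner ℂ (u i) x = 0 := by
  let T : V →ₗ[ℂ] (Fin n → ℂ) :=
    LinearMap.pi fun i => (innerSL ℂ (u i)).toLinearMap ∘ₗ V.subtype
  have hker : T.ker ≠ ⊥ := LinearMap.ker_ne_bot_of_finrank_lt (by simpa using hV)
  obtain ⟨x, hx, hx0⟩ := T.ker.exists_mem_ne_zero_of_ne_bot hker
  have hx0' : (x : H) ≠ 0 := fun h => hx0 (Subtype.ext h)
  have hT : ∀ i, inner ℂ (u i) (x : H) = 0 := fun i => congrFun (LinearMap.mem_ker.1 hx) i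
  refine ⟨((‖(x : H)‖⁻¹ : ℝ) : ℂ) • (x : H), V.smul_mem _ x.2, ?_, fun i => ?_⟩
  · rw [norm_smul, Complex.norm_real, norm_inv, norm_norm,
      inv_mul_cancel₀ (norm_ne_zero_iff.2 hx0')]
  · rw [inner_smul_right, hT, mul_zero]

/-- This replaces the min-max principle: the span of `N + 1` independent eigenfunctions below `t (N
+ 1)` contains a unit vector orthogonal to the `N` already chosen, and its energy is at most `t (N +
1)`. No compatibility between the eigenfunctions for different `n` is needed. -/
lemma exists_orthonormal_sum_energy_le {s : ℝ} (hs : 0 ≤ s) (hs' : s ≤ 1)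
    {Ω : Set (EuclideanSpace ℝ (Fin d))} {t : ℕ → ℝ} (ht : ∀ n, HasEigenvaluesBelow s Ω n (t n))
    (N : ℕ) : ∃ u : Fin N → L2 d, Orthonormal ℂ u ∧
      (∀ i, MemDirichletSpace s Ω (u i) ∧ energy s (u i) < ⊤) ∧
      ∑ i, (energy s (u i)).toReal ≤ ∑ n ∈ Finset.Icc 1 N, t n := by
  induction N with
  | zero => exact ⟨Fin.elim0, ⟨fun i => i.elim0, fun i => i.elim0⟩, fun i => i.elim0, by simp⟩
  | succ N ih =>
    obtain ⟨u, hu, hmem, hsum⟩ := ih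
    obtain ⟨f, hf, hE⟩ := ht (N + 1)
    have : FiniteDimensional ℂ (Submodule.span ℂ (Set.range f)) :=
      FiniteDimensional.span_of_finite ℂ (Set.finite_range f)
    obtain ⟨x, hxV, hx1, hxu⟩ := exists_norm_eq_one_inner_eq_zero u
      (Submodule.span ℂ (Set.range f)) (by rw [finrank_span_eq_card hf]; simp)
    obtain ⟨h1, h2, h3⟩ := energy_le_of_mem_span hs hs' hE hxV
    rw [hx1, one_pow, mul_one] at h3
    refine ⟨Fin.cons x u, orthonormal_fin_cons hu hx1 hxu, Fin.cases ⟨h1, h2⟩ hmem, ?_⟩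
    rw [Fin.sum_univ_succ, Finset.sum_Icc_succ_top (by omega)]
    simp only [Fin.cons_zero, Fin.cons_succ]
    linarith

end AnisotropicDirichlet

end

/-! ### The bound for the eigenvalue sum -/

theorem mainTheorem4 (d : ℕ) (hd : 1 ≤ d) (s : ℝ) (hs : 1 / 2 < s) (hs' : s ≤ 1)
    (Ω : Set (EuclideanSpace ℝ (Fin d))) (hΩ : AnisotropicDirichlet.IsTilingDomain Ω) (N : ℕ) :
    AnisotropicDirichlet.eigenvalueSum s Ω N ≥
      (2 * Real.pi) ^ (2 * s) * ((d : ℝ) / ((d : ℝ) + 2 * s)) *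
        ((d : ℝ) / (AnisotropicDirichlet.sphereVolume d s * (volume Ω).toReal)) ^ (2 * s / (d : ℝ)) *
        (N : ℝ) ^ (1 + 2 * s / (d : ℝ)) := by
  open AnisotropicDirichlet in
  have hs0 : 0 ≤ s := by linarith
  refine le_of_forall_pos_le_add fun δ hδ => ?_
  -- Near-minimisers suffice, so the infimum need not be attained. The denominator `N + 1` keeps the
  -- total error below `δ` and is nonzero for `N = 0`.
  have hex : ∀ n, ∃ t, HasEigenvaluesBelow s Ω n t ∧ t < eigenvalue s Ω n + δ / (N + 1) := by
    intro n
    obtain ⟨t, h1, h2⟩ := exists_lt_of_csInf_lt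
      (s := {t : ℝ | HasEigenvaluesBelow s Ω n t})
      (exists_hasEigenvaluesBelow hd hs hs' hΩ.isOpen hΩ.nonempty hΩ.volume_lt_top n)
      (lt_add_of_pos_right (eigenvalue s Ω n) (by positivity : 0 < δ / (N + 1)))
    exact ⟨t, h1, h2⟩
  choose t ht htlt using hex
  obtain ⟨u, hu, hmem, hsum⟩ := exists_orthonormal_sum_energy_le hs0 hs' ht N
  have hcut : ∀ i, cutoff Ω hΩ.isOpen.measurableSet (u i) = u i := by
    intro i
    obtain ⟨g, hg, hgu⟩ := exists_mem_dirichletPreimage hs0 hs' (hmem i).1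
    rw [← hgu, cutoff_resolventSqrt hΩ.isOpen.measurableSet hg]
  refine (le_sum_energy_toReal hd hs hΩ.isOpen.measurableSet hΩ.volume_lt_top
    (hΩ.isOpen.measure_pos volume hΩ.nonempty) hu hcut fun i => (hmem i).2).trans
    (hsum.trans ?_)
  calc ∑ n ∈ Finset.Icc 1 N, t n
      ≤ ∑ n ∈ Finset.Icc 1 N, (eigenvalue s Ω n + δ / (N + 1)) :=
        Finset.sum_le_sum fun n _ => (htlt n).le
    _ = eigenvalueSum s Ω N + N * (δ / (N + 1)) := by
        rw [Finset.sum_add_distrib, eigenvalueSum]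
        simp
    _ ≤ eigenvalueSum s Ω N + δ := by
        gcongr
        rw [mul_div_assoc', div_le_iff₀ (by positivity)]
        nlinarith
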